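/- **Setting.** Let $\Omega\subset\mathbb R^3$ be a bounded domain (open, connected) with smooth boundary, $\partial\Omega=\Gamma_D\cup\Gamma_N$ with $\Gamma_D\cap\Gamma_N=\emptyset$, $\Gamma_D,\Gamma_N$ measurable and of positive surface measure, and let $T>0$, $\nu\in(0,1]$, $Q=(0,T)\times\Omega$. Put $\boldsymbol H=L^2(\Omega)^3$, $\boldsymbol V=\{\boldsymbol z\in H^1(\Omega)^3:\boldsymbol z=\boldsymbol 0\text{ a.e. on }\Gamma_D\}$ (a Hilbert space for the $H^1$ norm, or equivalently for the norm of the gradient), $\boldsymbol V^*$ its dual, with $\boldsymbol H\subset\boldsymbol V^*$ through $\langle\boldsymbol u,\boldsymbol z\rangle=(\boldsymbol u,\boldsymbol z)_{\boldsymbol H}$, and $$((\boldsymbol z,\tilde{\boldsymbol z}))=\sum_{i,j=1}^3\int_\Omega\frac{\partial z_i}{\partial x_j}\frac{\partial\tilde z_i}{\partial x_j}\,dx,\qquad \varepsilon_{ij}(\boldsymbol z)=\tfrac12\Bigl(\frac{\partial z_i}{\partial x_j}+\frac{\partial z_j}{\partial x_i}\Bigr).$$ Let $\mathbb H=\{\tau=\{\tau_{ij}\}_{i,j=1}^3:\tau_{ij}=\tau_{ji}\in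 L^2(\Omega)\}$ with $(\tau,\tilde\tau)_{\mathbb H}=\sum_{i,j}\int_\Omega\tau_{ij}\tilde\tau_{ij}\,dx$, and let $\mathbb V$ be the set of $\tau\in\mathbb H$ with (weak, row-wise) divergence $\mathbf{div}\,\tau\in\boldsymbol H$ and normal trace zero on $\Gamma_N$, i.e. $(\varepsilon(\boldsymbol z),\tau)_{\mathbb H}+(\mathbf{div}\,\tau,\boldsymbol z)_{\boldsymbol H}=0$ for all $\boldsymbol z\in\boldsymbol V$. For $t\in[0,T]$ let $$\tilde K(t)=\bigl\{\tau\in\mathbb H:\tfrac12|\tau^D(x)|^2\le g(t,x)\text{ for a.a. }x\in\Omega\bigr\},\qquad K(t)=\tilde K(t)-\sigma_*(t),$$ where $\tau^D_{ij}=\tau_{ij}-\frac13\bigl(\sum_k\tau_{kk}\bigr)\delta_{ij}$ and $|\tau|^2=\sum_{i,j}\tau_{ij}^2$. Functions in $H^1(0,T;X)$ are identified with their continuous representatives. **Theorem 2.3.** Assume that - $\boldsymbol f\in L^2(0,T;\boldsymbol H)$ and $h\in L^2(0,T;\mathbb H)$; - $\boldsymbol v_0\in\boldsymbol V$ and $\sigma_0\in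 K(0)\cap\mathbb V$; - $\sigma_*\in H^1(0,T;\mathbb H)$; - $g\in H^1(0,T;C(\overline\Omega))\cap C(\overline Q)$; - there are constants $C_1,C_2>0$ with $C_1\le g(t,x)\le C_2$ for all $(t,x)\in\overline Q$. Then there exists a unique pair $(\boldsymbol v,\sigma)$ with $$\boldsymbol v\in H^1(0,T;\boldsymbol V^*)\cap L^\infty(0,T;\boldsymbol H)\cap L^2(0,T;\boldsymbol V),\qquad \sigma\in H^1(0,T;\mathbb H),\qquad \sigma(t)\in K(t)\ \text{ for all }t\in[0,T],$$ such that $\boldsymbol v(0)=\boldsymbol v_0$ in $\boldsymbol H$, $\sigma(0)=\sigma_0$ in $\mathbb H$, and, for a.a. $t\in(0,T)$, $$\langle\boldsymbol v'(t),\boldsymbol z\rangle_{\boldsymbol V^*,\boldsymbol V}+\nu((\boldsymbol v(t),\boldsymbol z))+(\sigma(t),\varepsilon(\boldsymbol z))_{\mathbb H}=(\boldsymbol f(t),\boldsymbol z)_{\boldsymbol H}\quad\text{for all }\boldsymbol z\in\boldsymbol V,$$ $$(\sigma'(t),\sigma(t)-\tau)_{\mathbb H}-(\varepsilon(\boldsymbol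 v(t)),\sigma(t)-\tau)_{\mathbb H}\le(h(t),\sigma(t)-\tau)_{\mathbb H}\quad\text{for all }\tau\in K(t).$$ The last inequality, with $\sigma(t)\in K(t)$, is the Moreau sweeping process $\sigma'(t)+\partial I_{K(t)}(\sigma(t))\ni\varepsilon(\boldsymbol v(t))+h(t)$ in $\mathbb H$. -/

import Mathlib

open MeasureTheory Set Filter Topology
open scoped ENNReal ContDiff BoundedContinuousFunction

namespace ViscousPlasticity

noncomputable section

/-! ## Domains, vectors and tensors -/

/-- Points of `ℝ³`, and vectors in `ℝ³`. -/
abbrev E3 : Type := EuclideanSpace ℝ (Fin 3)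

/-- All `3 × 3` tensors, with the norm `|τ|² = ∑ i j, τ i j ^ 2`. -/
abbrev Tensor : Type := EuclideanSpace ℝ (Fin 3 × Fin 3)

/-- The symmetric `3 × 3` tensors, with the norm inherited from `Tensor`. -/
def symTensors : Submodule ℝ Tensor where
  carrier := {τ | ∀ i j, τ (i, j) = τ (j, i)}
  add_mem' := by
    intro a b ha hb i j
    simp [ha i j, hb i j]
  zero_mem' := by
    intro i j
    simp
  smul_mem' := by
    intro c a ha i j
    simp [ha i j]

/-- The type of symmetric `3 × 3` tensors, with the Hilbert space structure of `symTensors`. -/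
def SymTensor : Type := symTensors

instance : NormedAddCommGroup SymTensor := inferInstanceAs (NormedAddCommGroup symTensors)

instance : InnerProductSpace ℝ SymTensor := inferInstanceAs (InnerProductSpace ℝ symTensors)

instance : FiniteDimensional ℝ SymTensor := inferInstanceAs (FiniteDimensional ℝ symTensors)

instance : CompleteSpace SymTensor := FiniteDimensional.complete ℝ SymTensor

/-- A symmetric tensor as a tensor. -/
def SymTensor.toTensor (τ : SymTensor) : Tensor := Subtype.val (p := (· ∈ symTensors)) τ

/-- The symmetric part `(G + Gᵀ) / 2` of a tensor, as an element of `symTensors`. -/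
def symPartAux : Tensor →ₗ[ℝ] symTensors where
  toFun := fun G =>
    ⟨WithLp.toLp 2 fun p : Fin 3 × Fin 3 => (1 / 2 : ℝ) * (G (p.1, p.2) + G (p.2, p.1)), by
      intro i j
      simp [add_comm]⟩
  map_add' := by
    intro a b
    ext p
    simp
    ring
  map_smul' := by
    intro c a
    ext p
    simp
    ring

/-- The symmetric part `(G + Gᵀ) / 2` of a tensor. -/
def symPart : Tensor →L[ℝ] SymTensor :=
  LinearMap.toContinuousLinearMap (F' := SymTensor)
    { toFun := fun G => symPartAux G
      map_add' := fun a b => symPartAux.map_add a b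
      map_smul' := fun c a => symPartAux.map_smul c a }

/-- The deviator `τ^D`, with `τ^D i j = τ i j - (1/3) (∑ k, τ k k) δ i j`. -/
def deviator (τ : SymTensor) : Tensor :=
  WithLp.toLp 2 fun p : Fin 3 × Fin 3 =>
    τ.toTensor p - (1 / 3 : ℝ) * (∑ k, τ.toTensor (k, k)) * (if p.1 = p.2 then 1 else 0)

/-- Bounded domains of `ℝ³` with smooth boundary: near each boundary point, `Ω` is the sublevel
set `{ρ < 0}` of a smooth function whose differential does not vanish at that point. -/
structure IsSmoothDomain (Ω : Set E3) : Prop where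
  isOpen : IsOpen Ω
  isConnected : IsConnected Ω
  isBounded : Bornology.IsBounded Ω
  smooth_boundary : ∀ x ∈ frontier Ω, ∃ U ∈ 𝓝 x, ∃ ρ : E3 → ℝ,
    ContDiff ℝ ∞ ρ ∧ fderiv ℝ ρ x ≠ 0 ∧ ∀ y ∈ U, (y ∈ Ω ↔ ρ y < 0)

/-! ## Function spaces on `Ω` -/

/-- `L²(Ω)³`. -/
abbrev HVec (Ω : Set E3) : Type := Lp E3 2 (volume.restrict Ω)

/-- `L²(Ω)^{3×3}`. -/
abbrev HGrad (Ω : Set E3) : Type := Lp Tensor 2 (volume.restrict Ω)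

/-- Symmetric tensor fields with entries in `L²(Ω)`;
the inner product is `∑ i j, ∫_Ω τ i j * τ' i j`. -/
abbrev HSym (Ω : Set E3) : Type := Lp SymTensor 2 (volume.restrict Ω)

/-- The partial derivative `∂φ/∂x_j`. -/
def partialDeriv (φ : E3 → ℝ) (j : Fin 3) (x : E3) : ℝ :=
  fderiv ℝ φ x (EuclideanSpace.single j 1)

/-- The Jacobian of a vector field; its `(i, j)` entry is `∂φ_i/∂x_j`. -/
def jacobian (φ : E3 → E3) (x : E3) : Tensor :=
  WithLp.toLp 2 fun p : Fin 3 × Fin 3 => fderiv ℝ φ x (EuclideanSpace.single p.2 1) p.1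

/-- Scalar test functions on `Ω`, i.e. `C_c^∞(Ω)`. -/
structure IsTest (Ω : Set E3) (φ : E3 → ℝ) : Prop where
  smooth : ContDiff ℝ ∞ φ
  hasCompactSupport : HasCompactSupport φ
  tsupport_subset : tsupport φ ⊆ Ω

/-- `G` is the weak gradient of `z` in `Ω`: `G i j = ∂z_i/∂x_j`. -/
def HasWeakGrad (Ω : Set E3) (z : HVec Ω) (G : HGrad Ω) : Prop :=
  ∀ φ : E3 → ℝ, IsTest Ω φ → ∀ i j : Fin 3,
    ∫ x in Ω, z x i * partialDeriv φ j x = - ∫ x in Ω, G x (i, j) * φ x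

/-- `d` is the weak (row-wise) divergence of `τ` in `Ω`: `d i = ∑ j, ∂τ_ij/∂x_j`. -/
def HasWeakDiv (Ω : Set E3) (τ : HSym Ω) (d : HVec Ω) : Prop :=
  ∀ φ : E3 → ℝ, IsTest Ω φ → ∀ i : Fin 3,
    ∑ j : Fin 3, ∫ x in Ω, (τ x).toTensor (i, j) * partialDeriv φ j x = - ∫ x in Ω, d x i * φ x

/-- The `H¹` field `z` with weak gradient `G` has trace zero almost everywhere on the part `S` of
the boundary: it is the `H¹(Ω)`-limit of fields that are smooth up to the boundary and whose
boundary values tend to zero in `L²(S)` for the surface measure. As the trace operator is the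
continuous extension to `H¹(Ω)³`, with values in `L²(∂Ω)³`, of the restriction of smooth fields to
`∂Ω`, this says that the trace vanishes a.e. on `S`. -/
def HasZeroTraceOn (Ω S : Set E3) (z : HVec Ω) (G : HGrad Ω) : Prop :=
  ∃ φ : ℕ → E3 → E3, (∀ n, ContDiff ℝ ∞ (φ n)) ∧
    Tendsto (fun n => eLpNorm (fun x => φ n x - z x) 2 (volume.restrict Ω)) atTop (𝓝 0) ∧
    Tendsto (fun n => eLpNorm (fun x => jacobian (φ n) x - G x) 2 (volume.restrict Ω))
      atTop (𝓝 0) ∧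
    Tendsto (fun n => eLpNorm (φ n) 2 ((μH[2] : Measure E3).restrict S)) atTop (𝓝 0)

theorem jacobian_add {φ ψ : E3 → E3} (hφ : ContDiff ℝ ∞ φ) (hψ : ContDiff ℝ ∞ ψ) (x : E3) :
    jacobian (φ + ψ) x = jacobian φ x + jacobian ψ x := by
  have h1 : DifferentiableAt ℝ φ x := (hφ.differentiable (by simp)) x
  have h2 : DifferentiableAt ℝ ψ x := (hψ.differentiable (by simp)) x
  ext p
  simp [jacobian, fderiv_add h1 h2]

theorem jacobian_smul {φ : E3 → E3} (hφ : ContDiff ℝ ∞ φ) (c : ℝ) (x : E3) :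
    jacobian (c • φ) x = c • jacobian φ x := by
  have h1 : DifferentiableAt ℝ φ x := (hφ.differentiable (by simp)) x
  ext p
  simp [jacobian, fderiv_const_smul h1 c]

theorem continuous_jacobian {φ : E3 → E3} (hφ : ContDiff ℝ ∞ φ) : Continuous (jacobian φ) := by
  have h1 : Continuous (fderiv ℝ φ) := hφ.continuous_fderiv (by simp)
  unfold jacobian
  fun_prop

theorem tendsto_eLpNorm_add {F : Type*} [NormedAddCommGroup F] {μ : Measure E3}
    {a b c : ℕ → E3 → F} (ha : ∀ n, AEStronglyMeasurable (a n) μ)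
    (hb : ∀ n, AEStronglyMeasurable (b n) μ) (hc : ∀ n, c n =ᵐ[μ] a n + b n)
    (h1 : Tendsto (fun n => eLpNorm (a n) 2 μ) atTop (𝓝 0))
    (h2 : Tendsto (fun n => eLpNorm (b n) 2 μ) atTop (𝓝 0)) :
    Tendsto (fun n => eLpNorm (c n) 2 μ) atTop (𝓝 0) := by
  have h3 := h1.add h2
  rw [add_zero] at h3
  refine tendsto_of_tendsto_of_tendsto_of_le_of_le tendsto_const_nhds h3
    (fun _ => zero_le) (fun n => ?_)
  simp only
  rw [eLpNorm_congr_ae (hc n)]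
  exact eLpNorm_add_le (ha n) (hb n) (by norm_num)

theorem tendsto_eLpNorm_smul {F : Type*} [NormedAddCommGroup F] [NormedSpace ℝ F]
    {μ : Measure E3} {a c : ℕ → E3 → F} (r : ℝ) (hc : ∀ n, c n =ᵐ[μ] r • a n)
    (h1 : Tendsto (fun n => eLpNorm (a n) 2 μ) atTop (𝓝 0)) :
    Tendsto (fun n => eLpNorm (c n) 2 μ) atTop (𝓝 0) := by
  have h3 := ENNReal.Tendsto.const_mul (a := ‖r‖ₑ) h1 (Or.inr enorm_ne_top)
  rw [mul_zero] at h3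
  refine h3.congr (fun n => ?_)
  rw [eLpNorm_congr_ae (hc n), eLpNorm_const_smul]

theorem HasZeroTraceOn.add {Ω S : Set E3} {z z' : HVec Ω} {G G' : HGrad Ω}
    (h : HasZeroTraceOn Ω S z G) (h' : HasZeroTraceOn Ω S z' G') :
    HasZeroTraceOn Ω S (z + z') (G + G') := by
  obtain ⟨φ, hφ, h1, h2, h3⟩ := h
  obtain ⟨ψ, hψ, k1, k2, k3⟩ := h'
  refine ⟨fun n => φ n + ψ n, fun n => (hφ n).add (hψ n), ?_, ?_, ?_⟩
  · refine tendsto_eLpNorm_add (fun n => ?_) (fun n => ?_) (fun n => ?_) h1 k1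
    · exact (hφ n).continuous.aestronglyMeasurable.sub (Lp.aestronglyMeasurable z)
    · exact (hψ n).continuous.aestronglyMeasurable.sub (Lp.aestronglyMeasurable z')
    · filter_upwards [Lp.coeFn_add z z'] with x hx
      simp only [Pi.add_apply, hx]
      abel
  · refine tendsto_eLpNorm_add (fun n => ?_) (fun n => ?_) (fun n => ?_) h2 k2
    · exact (continuous_jacobian (hφ n)).aestronglyMeasurable.sub (Lp.aestronglyMeasurable G)
    · exact (continuous_jacobian (hψ n)).aestronglyMeasurable.sub (Lp.aestronglyMeasurable G')
    · filter_upwards [Lp.coeFn_add G G'] with x hx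
      simp only [Pi.add_apply, hx, jacobian_add (hφ n) (hψ n)]
      abel
  · exact tendsto_eLpNorm_add (fun n => (hφ n).continuous.aestronglyMeasurable)
      (fun n => (hψ n).continuous.aestronglyMeasurable) (fun n => Filter.EventuallyEq.rfl) h3 k3

theorem HasZeroTraceOn.smul {Ω S : Set E3} {z : HVec Ω} {G : HGrad Ω} (r : ℝ)
    (h : HasZeroTraceOn Ω S z G) : HasZeroTraceOn Ω S (r • z) (r • G) := by
  obtain ⟨φ, hφ, h1, h2, h3⟩ := h
  refine ⟨fun n => r • φ n, fun n => contDiff_const.smul (hφ n), ?_, ?_, ?_⟩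
  · refine tendsto_eLpNorm_smul r (fun n => ?_) h1
    filter_upwards [Lp.coeFn_smul r z] with x hx
    simp only [Pi.smul_apply, hx, smul_sub]
  · refine tendsto_eLpNorm_smul r (fun n => ?_) h2
    filter_upwards [Lp.coeFn_smul r G] with x hx
    simp only [Pi.smul_apply, hx, smul_sub, jacobian_smul (hφ n)]
  · exact tendsto_eLpNorm_smul r (fun n => Filter.EventuallyEq.rfl) h3

theorem HasZeroTraceOn.zero (Ω S : Set E3) : HasZeroTraceOn Ω S 0 0 := by
  have hz : ∀ x, jacobian (0 : E3 → E3) x = 0 := by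
    intro x
    ext p
    simp [jacobian]
  refine ⟨fun _ => 0, fun _ => contDiff_const, ?_, ?_, ?_⟩
  · refine tendsto_const_nhds.congr (fun n => ?_)
    rw [eq_comm, ← eLpNorm_zero (p := 2) (μ := volume.restrict Ω) (ε := E3)]
    refine eLpNorm_congr_ae ?_
    filter_upwards [Lp.coeFn_zero E3 2 (volume.restrict Ω)] with x hx
    have hx' : (0 : HVec Ω) x = 0 := hx
    simp only [hx', Pi.zero_apply, sub_zero]
  · refine tendsto_const_nhds.congr (fun n => ?_)
    rw [eq_comm, ← eLpNorm_zero (p := 2) (μ := volume.restrict Ω) (ε := Tensor)]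
    refine eLpNorm_congr_ae ?_
    filter_upwards [Lp.coeFn_zero Tensor 2 (volume.restrict Ω)] with x hx
    have hx' : (0 : HGrad Ω) x = 0 := hx
    have hz' := hz x
    simp only [hx', sub_zero, Pi.zero_apply]
    exact hz'
  · simp

theorem IsTest.memLp {Ω : Set E3} {φ : E3 → ℝ} (h : IsTest Ω φ) :
    MemLp φ 2 (volume.restrict Ω) :=
  h.smooth.continuous.memLp_of_hasCompactSupport h.hasCompactSupport

theorem IsTest.memLp_partialDeriv {Ω : Set E3} {φ : E3 → ℝ} (h : IsTest Ω φ) (j : Fin 3) :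
    MemLp (partialDeriv φ j) 2 (volume.restrict Ω) := by
  have h1 : Continuous (fderiv ℝ φ) := h.smooth.continuous_fderiv (by simp)
  refine Continuous.memLp_of_hasCompactSupport (by unfold partialDeriv; fun_prop) ?_
  exact h.hasCompactSupport.fderiv_apply ℝ _

theorem memLp_coord {ι : Type*} [Fintype ι] {Ω : Set E3}
    (z : Lp (EuclideanSpace ℝ ι) 2 (volume.restrict Ω)) (i : ι) :
    MemLp (fun x => z x i) 2 (volume.restrict Ω) :=
  (EuclideanSpace.proj (𝕜 := ℝ) i : EuclideanSpace ℝ ι →L[ℝ] ℝ).comp_memLp z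

theorem HasWeakGrad.add {Ω : Set E3} {z z' : HVec Ω} {G G' : HGrad Ω}
    (h : HasWeakGrad Ω z G) (h' : HasWeakGrad Ω z' G') :
    HasWeakGrad Ω (z + z') (G + G') := by
  intro φ hφ i j
  have e1 : ∫ x in Ω, (z + z') x i * partialDeriv φ j x
      = ∫ x in Ω, (z x i * partialDeriv φ j x + z' x i * partialDeriv φ j x) := by
    refine integral_congr_ae ?_
    filter_upwards [Lp.coeFn_add z z'] with x hx
    have hx' : (z + z') x = z x + z' x := hx
    rw [hx', PiLp.add_apply, add_mul]
  have e2 : ∫ x in Ω, (G + G') x (i, j) * φ x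
      = ∫ x in Ω, (G x (i, j) * φ x + G' x (i, j) * φ x) := by
    refine integral_congr_ae ?_
    filter_upwards [Lp.coeFn_add G G'] with x hx
    have hx' : (G + G') x = G x + G' x := hx
    rw [hx', PiLp.add_apply, add_mul]
  have e3 := integral_add ((memLp_coord z i).integrable_mul (hφ.memLp_partialDeriv j))
    ((memLp_coord z' i).integrable_mul (hφ.memLp_partialDeriv j))
  have e4 := integral_add ((memLp_coord G (i, j)).integrable_mul hφ.memLp)
    ((memLp_coord G' (i, j)).integrable_mul hφ.memLp)
  simp only [Pi.mul_apply] at e3 e4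
  rw [e1, e2, e3, e4, h φ hφ i j, h' φ hφ i j]
  ring

theorem HasWeakGrad.smul {Ω : Set E3} {z : HVec Ω} {G : HGrad Ω} (r : ℝ)
    (h : HasWeakGrad Ω z G) : HasWeakGrad Ω (r • z) (r • G) := by
  intro φ hφ i j
  have e1 : ∫ x in Ω, (r • z) x i * partialDeriv φ j x
      = ∫ x in Ω, r * (z x i * partialDeriv φ j x) := by
    refine integral_congr_ae ?_
    filter_upwards [Lp.coeFn_smul r z] with x hx
    simp [hx, mul_assoc]
  have e2 : ∫ x in Ω, (r • G) x (i, j) * φ x = ∫ x in Ω, r * (G x (i, j) * φ x) := by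
    refine integral_congr_ae ?_
    filter_upwards [Lp.coeFn_smul r G] with x hx
    simp [hx, mul_assoc]
  rw [e1, e2, integral_const_mul, integral_const_mul, h φ hφ i j]
  ring

theorem HasWeakGrad.zero (Ω : Set E3) : HasWeakGrad Ω 0 0 := by
  intro φ hφ i j
  have e1 : ∫ x in Ω, (0 : HVec Ω) x i * partialDeriv φ j x = 0 := by
    refine integral_eq_zero_of_ae ?_
    filter_upwards [Lp.coeFn_zero E3 2 (volume.restrict Ω)] with x hx
    have hx' : (0 : HVec Ω) x = 0 := hx
    change _ = (0 : ℝ)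
    rw [hx']
    simp
  have e2 : ∫ x in Ω, (0 : HGrad Ω) x (i, j) * φ x = 0 := by
    refine integral_eq_zero_of_ae ?_
    filter_upwards [Lp.coeFn_zero Tensor 2 (volume.restrict Ω)] with x hx
    have hx' : (0 : HGrad Ω) x = 0 := hx
    change _ = (0 : ℝ)
    rw [hx']
    simp
  rw [e1, e2, neg_zero]

/-- The space `V = {z ∈ H¹(Ω)³ : z = 0 a.e. on Γ_D}`, as the space of pairs consisting of a field
`z` and its weak gradient, with the norm `(|z|² + |∇z|²)^{1/2}` of `H¹(Ω)³`. On a bounded domain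
with `|Γ_D| > 0` this norm is equivalent on `V` to the gradient norm (Poincaré's inequality), so
both give the same dual space and the same spaces of functions of time with values in `V`, `V*`. -/
def VSub (Ω ΓD : Set E3) : Submodule ℝ (WithLp 2 (HVec Ω × HGrad Ω)) where
  carrier := {p | HasWeakGrad Ω p.fst p.snd ∧ HasZeroTraceOn Ω ΓD p.fst p.snd}
  add_mem' := fun ha hb => ⟨ha.1.add hb.1, ha.2.add hb.2⟩
  zero_mem' := ⟨HasWeakGrad.zero Ω, HasZeroTraceOn.zero Ω ΓD⟩
  smul_mem' := fun r _ ha => ⟨ha.1.smul r, ha.2.smul r⟩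

/-- The space `V`. -/
abbrev VSp (Ω ΓD : Set E3) : Type := VSub Ω ΓD

/-- The dual space `V*`. -/
abbrev VDual (Ω ΓD : Set E3) : Type := StrongDual ℝ (VSp Ω ΓD)

/-- The inclusion of `V` in `L²(Ω)³`. -/
def toH (Ω ΓD : Set E3) : VSp Ω ΓD →L[ℝ] HVec Ω :=
  (WithLp.fstL 2 ℝ (HVec Ω) (HGrad Ω)).comp (VSub Ω ΓD).subtypeL

/-- The weak gradient `∇z`, with entries `∂z_i/∂x_j`. -/
def grad (Ω ΓD : Set E3) : VSp Ω ΓD →L[ℝ] HGrad Ω :=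
  (WithLp.sndL 2 ℝ (HVec Ω) (HGrad Ω)).comp (VSub Ω ΓD).subtypeL

/-- The strain `ε(z)`, with entries `(1/2) (∂z_i/∂x_j + ∂z_j/∂x_i)`. -/
def strain (Ω ΓD : Set E3) : VSp Ω ΓD →L[ℝ] HSym Ω :=
  (symPart.compLpL 2 (volume.restrict Ω)).comp (grad Ω ΓD)

/-- The bilinear form `((z, z')) = ∑ i j, ∫_Ω (∂z_i/∂x_j) (∂z'_i/∂x_j)`. -/
def gradForm (Ω ΓD : Set E3) (z z' : VSp Ω ΓD) : ℝ :=
  inner ℝ (grad Ω ΓD z) (grad Ω ΓD z')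

/-- The embedding of `L²(Ω)³` in `V*`: `⟨u, z⟩ = (u, z)`. -/
def toVDual (Ω ΓD : Set E3) (u : HVec Ω) : VDual Ω ΓD :=
  (innerSL ℝ u).comp (toH Ω ΓD)

/-- The space `{τ ∈ ℍ : div τ ∈ L²(Ω)³, τ ν = 0 on Γ_N}`. The normal trace `τ ν` is the functional
`z ↦ (ε(z), τ) + (div τ, z)` of the boundary values of `z`; it vanishes on `Γ_N` if it vanishes
on all `z` with zero boundary values on `Γ_D`, the rest of the boundary. -/
def VSym (Ω ΓD : Set E3) : Set (HSym Ω) :=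
  {τ | ∃ d : HVec Ω, HasWeakDiv Ω τ d ∧
    ∀ z : VSp Ω ΓD, inner ℝ (strain Ω ΓD z) τ + inner ℝ d (toH Ω ΓD z) = 0}

/-! ## Functions of time -/

/-- Lebesgue measure on the time interval `(0, T)`. -/
def timeMeasure (T : ℝ) : Measure ℝ := volume.restrict (Ioo 0 T)

/-- `u ∈ H¹(0,T;X)` with `u' = w`, where `u` stands for the continuous representative:
`w ∈ L²(0,T;X)`, and `u` is the indefinite integral of `w` on `[0,T]`. -/
def HasH1Deriv {X : Type*} [NormedAddCommGroup X] [NormedSpace ℝ X] (T : ℝ) (u w : ℝ → X) : Prop :=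
  MemLp w 2 (timeMeasure T) ∧ ∀ t ∈ Icc 0 T, u t = u 0 + ∫ s in (0 : ℝ)..t, w s

/-! ## The model -/

/-- The set `K̃(t) = {τ ∈ ℍ : (1/2) |τ^D(x)|² ≤ g(t,x) for a.a. x ∈ Ω}`,
for the function `gt = g(t, ·)`. -/
def Ktilde (Ω : Set E3) (gt : closure Ω →ᵇ ℝ) : Set (HSym Ω) :=
  {τ | ∀ᵐ x ∂(volume.restrict Ω), ∀ hx : x ∈ Ω,
    (1 / 2 : ℝ) * ‖deviator (τ x)‖ ^ 2 ≤ gt ⟨x, subset_closure hx⟩}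

/-- The constraint set `K(t) = K̃(t) - σ_*(t)`. -/
def K (Ω : Set E3) (g : ℝ → (closure Ω →ᵇ ℝ)) (σstar : ℝ → HSym Ω) (t : ℝ) : Set (HSym Ω) :=
  {τ | τ + σstar t ∈ Ktilde Ω (g t)}

/-- `(v, σ)` is a solution of the viscous perfect plasticity model with viscosity `ν` and data
`f`, `h`, `σ_*`, `g`, `v₀`, `σ₀`. Here `u` is `v` as an element of `L²(0,T;V)`, `v'` is the time
derivative of `v` in `V*`, and `σ'` the time derivative of `σ` in `ℍ`. The values `v t`, `σ t` for
`t ∈ [0,T]` are those of the representatives of `v` and `σ` that are continuous with values in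
`V*` and in `ℍ`. -/
def IsSolution (Ω ΓD : Set E3) (T ν : ℝ) (f : ℝ → HVec Ω) (h σstar : ℝ → HSym Ω)
    (g : ℝ → (closure Ω →ᵇ ℝ)) (v₀ : VSp Ω ΓD) (σ₀ : HSym Ω)
    (v : ℝ → HVec Ω) (σ : ℝ → HSym Ω) : Prop :=
  ∃ (u : ℝ → VSp Ω ΓD) (v' : ℝ → VDual Ω ΓD) (σ' : ℝ → HSym Ω),
    -- `v ∈ H¹(0,T;V*) ∩ L^∞(0,T;H) ∩ L²(0,T;V)`
    HasH1Deriv T (fun t => toVDual Ω ΓD (v t)) v' ∧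
    MemLp v ∞ (timeMeasure T) ∧
    MemLp u 2 (timeMeasure T) ∧ (∀ᵐ t ∂(timeMeasure T), v t = toH Ω ΓD (u t)) ∧
    -- `σ ∈ H¹(0,T;ℍ)` and `σ(t) ∈ K(t)` for all `t`
    HasH1Deriv T σ σ' ∧
    (∀ t ∈ Icc 0 T, σ t ∈ K Ω g σstar t) ∧
    -- the equation of motion
    (∀ᵐ t ∂(timeMeasure T), ∀ z : VSp Ω ΓD,
      v' t z + ν * gradForm Ω ΓD (u t) z + inner ℝ (σ t) (strain Ω ΓD z)
        = inner ℝ (f t) (toH Ω ΓD z)) ∧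
    -- the variational inequality for the stress
    (∀ᵐ t ∂(timeMeasure T), ∀ τ ∈ K Ω g σstar t,
      inner ℝ (σ' t) (σ t - τ) - inner ℝ (strain Ω ΓD (u t)) (σ t - τ)
        ≤ inner ℝ (h t) (σ t - τ)) ∧
    -- the initial conditions
    v 0 = toH Ω ΓD v₀ ∧ σ 0 = σ₀

end

end ViscousPlasticity

/-!
The velocity depends on the stress through the linear parabolic equation, whose solution operator
`S` is causally monotone. Substituting it turns the system into a sweeping process for the stress
alone, perturbed by the causally monotone operator `e S e*`, where `e` is the strain. On
`L²(0,T;·)` a time derivative is the inverse of the Volterra operator `V`; replacing it by its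
Yosida approximation `(V + c)⁻¹` leaves a coercive variational inequality on the convex set of
`L²` selections of the moving set.

The approximate stress `x` splits as `y + c w`, where `w` approximates the stress rate and `y` is
the primitive of `w`. So `y` relaxes towards the moving set, which makes it a member of a set
enlarged by the motion of the yield threshold, and shrinking it towards `0` gives a selection at a
distance of order `c` from `y`. Testing with that selection bounds `w` uniformly in `c`. The
monotonicity of `V` and of `e S e*` then lets the variational inequality pass to a weak limit as
`c → 0`; it also gives uniqueness, in the form of an energy estimate.
-/

namespace ViscousPlasticity

noncomputable section

/-! ## Calculus in `L²(0,T;X)` -/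

section AbsolutelyContinuous

theorem absolutelyContinuousOnInterval_of_dist_le {X Y : Type*} [PseudoMetricSpace X]
    [PseudoMetricSpace Y] {F : ℝ → X} {G : ℝ → Y} {a b : ℝ}
    (hG : AbsolutelyContinuousOnInterval G a b)
    (h : ∀ r ∈ uIcc a b, ∀ s ∈ uIcc a b, dist (F r) (F s) ≤ dist (G r) (G s)) :
    AbsolutelyContinuousOnInterval F a b := by
  rw [absolutelyContinuousOnInterval_iff] at hG ⊢
  intro ε hε
  obtain ⟨δ, hδ, hsum⟩ := hG ε hε
  exact ⟨δ, hδ, fun I hI hlength => (Finset.sum_le_sum fun i hi =>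
    h _ (hI.1 i hi).1 _ (hI.1 i hi).2).trans_lt (hsum I hI hlength)⟩

variable {X : Type*} [NormedAddCommGroup X] [NormedSpace ℝ X] {w : ℝ → X} {a b : ℝ}

theorem absolutelyContinuousOnInterval_norm_integral (hw : IntervalIntegrable w volume a b) :
    AbsolutelyContinuousOnInterval (fun s => ‖∫ r in a..s, w r‖) a b := by
  have hint : ∀ s ∈ uIcc a b, IntervalIntegrable w volume a s := fun s hs =>
    hw.mono_set (uIcc_subset_uIcc_left hs)
  refine absolutelyContinuousOnInterval_of_dist_le
    (hw.norm.absolutelyContinuousOnInterval_intervalIntegral left_mem_uIcc) fun r hr s hs => ?_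
  rw [Real.dist_eq, Real.dist_eq,
    intervalIntegral.integral_interval_sub_left (hint r hr).norm (hint s hs).norm]
  refine (abs_norm_sub_norm_le _ _).trans ?_
  rw [intervalIntegral.integral_interval_sub_left (hint r hr) (hint s hs)]
  exact intervalIntegral.norm_integral_le_abs_integral_norm

theorem integral_inner_integral {X : Type*} [NormedAddCommGroup X] [InnerProductSpace ℝ X]
    [CompleteSpace X] {w : ℝ → X} {a b : ℝ} (hw : IntervalIntegrable w volume a b) :
    ∫ s in a..b, inner ℝ (w s) (∫ r in a..s, w r) = 1 / 2 * ‖∫ r in a..b, w r‖ ^ 2 := by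
  have hderiv : ∀ᵐ s, s ∈ uIcc a b → HasDerivAt (fun s => ‖∫ r in a..s, w r‖ ^ 2)
      (2 * inner ℝ (w s) (∫ r in a..s, w r)) s := by
    filter_upwards [hw.ae_hasDerivAt_integral] with s hs hmem
    rw [real_inner_comm]
    exact (hs hmem a left_mem_uIcc).norm_sq
  have hAC := absolutelyContinuousOnInterval_norm_integral hw
  have hFTC := (hAC.fun_mul hAC).integral_deriv_eq_sub
  simp only [← sq, intervalIntegral.integral_same, norm_zero] at hFTC
  rw [intervalIntegral.integral_congr_ae (g := fun s => 2 * inner ℝ (w s) (∫ r in a..s, w r)),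
    intervalIntegral.integral_const_mul] at hFTC
  · linarith
  · filter_upwards [hderiv] with s hs hmem
    exact (hs (uIoc_subset_uIcc hmem)).deriv

end AbsolutelyContinuous

/-- The space `L²(0,T;X)`. -/
abbrev TimeL2 (T : ℝ) (X : Type*) [NormedAddCommGroup X] : Type _ := Lp X 2 (timeMeasure T)

theorem timeMeasure_univ (T : ℝ) : timeMeasure T univ = ENNReal.ofReal T := by
  simp [timeMeasure]

instance isFiniteMeasure_timeMeasure (T : ℝ) : IsFiniteMeasure (timeMeasure T) :=
  ⟨by simp [timeMeasure_univ]⟩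

theorem timeMeasure_univ_rpow_toReal (T : ℝ) :
    ((timeMeasure T univ) ^ (1 / 2 : ℝ)).toReal = √T := by
  rw [timeMeasure_univ, ← ENNReal.toReal_rpow, ENNReal.toReal_ofReal', ← Real.sqrt_eq_rpow]
  rcases le_total T 0 with h | h
  · rw [max_eq_right h, Real.sqrt_zero, Real.sqrt_eq_zero_of_nonpos h]
  · rw [max_eq_left h]

section TimeMeasure

variable {X : Type*} [NormedAddCommGroup X] {T t : ℝ}

theorem TimeL2.integrable (w : TimeL2 T X) : Integrable w (timeMeasure T) :=
  (Lp.memLp w).integrable one_le_two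

theorem intervalIntegrable_of_integrable {w : ℝ → X} (hw : Integrable w (timeMeasure T))
    (ht : t ∈ Icc 0 T) : IntervalIntegrable w volume 0 t := by
  rw [intervalIntegrable_iff_integrableOn_Ioo_of_le ht.1]
  exact IntegrableOn.mono_set (t := Ioo 0 T) hw (Ioo_subset_Ioo_right ht.2)

theorem setIntegral_Iic_timeMeasure [NormedSpace ℝ X] (w : ℝ → X) (ht : t ∈ Icc 0 T) :
    ∫ s in Iic t, w s ∂(timeMeasure T) = ∫ s in (0 : ℝ)..t, w s := by
  have hset : (Iic t ∩ Ioo 0 T : Set ℝ) =ᵐ[volume] Ioc 0 t := by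
    rcases ht.2.eq_or_lt with rfl | htT
    · rw [inter_eq_right.2 fun s hs => hs.2.le]
      exact Ioo_ae_eq_Ioc
    · refine Filter.EventuallyEq.of_eq (Set.ext fun s => ?_)
      simp only [mem_inter_iff, mem_Iic, mem_Ioo, mem_Ioc]
      grind
  rw [intervalIntegral.integral_of_le ht.1, timeMeasure,
    Measure.restrict_restrict measurableSet_Iic, setIntegral_congr_set hset]

theorem TimeL2.integral_norm_le (w : TimeL2 T X) : ∫ s, ‖w s‖ ∂(timeMeasure T) ≤ √T * ‖w‖ := by
  rw [integral_norm_eq_lintegral_enorm (Lp.aestronglyMeasurable w),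
    ← eLpNorm_one_eq_lintegral_enorm, Lp.norm_def, ← timeMeasure_univ_rpow_toReal,
    ← ENNReal.toReal_mul, mul_comm]
  refine ENNReal.toReal_mono (ENNReal.mul_ne_top (Lp.eLpNorm_ne_top w)
    (ENNReal.rpow_ne_top_of_nonneg (by norm_num) (measure_ne_top _ _))) ?_
  convert eLpNorm_le_eLpNorm_mul_rpow_measure_univ (p := 1) (q := 2) one_le_two
    (Lp.aestronglyMeasurable w) using 3
  norm_num

theorem TimeL2.norm_setIntegral_le [NormedSpace ℝ X] (w : TimeL2 T X) (A : Set ℝ) :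
    ‖∫ s in A, w s ∂(timeMeasure T)‖ ≤ √T * ‖w‖ :=
  calc ‖∫ s in A, w s ∂(timeMeasure T)‖ ≤ ∫ s in A, ‖w s‖ ∂(timeMeasure T) :=
        norm_integral_le_integral_norm _
    _ ≤ ∫ s, ‖w s‖ ∂(timeMeasure T) :=
        setIntegral_le_integral w.integrable.norm (ae_of_all _ fun _ => norm_nonneg _)
    _ ≤ √T * ‖w‖ := w.integral_norm_le

theorem TimeL2.norm_le_of_ae_bound {u : TimeL2 T X} {C : ℝ} (hC : 0 ≤ C)
    (hu : ∀ᵐ t ∂(timeMeasure T), ‖u t‖ ≤ C) : ‖u‖ ≤ √T * C := by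
  rw [← timeMeasure_univ_rpow_toReal]
  convert Lp.norm_le_of_ae_bound hC hu using 2
  simp [measureUnivNNReal, ← ENNReal.coe_toNNReal_eq_toReal]

theorem memLp_of_continuousOn {u : ℝ → X} (hu : ContinuousOn u (Icc 0 T)) :
    MemLp u 2 (timeMeasure T) := by
  obtain ⟨C, hC⟩ := isCompact_Icc.exists_bound_of_continuousOn hu
  refine MemLp.of_bound ((hu.mono Ioo_subset_Icc_self).aestronglyMeasurable measurableSet_Ioo) C ?_
  exact ae_restrict_of_forall_mem measurableSet_Ioo fun t ht => hC t (Ioo_subset_Icc_self ht)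

theorem eqOn_of_ae_eq (hT : 0 < T) {u v : ℝ → X} (hu : ContinuousOn u (Icc 0 T))
    (hv : ContinuousOn v (Icc 0 T)) (h : u =ᵐ[timeMeasure T] v) : EqOn u v (Icc 0 T) :=
  (Measure.eqOn_open_of_ae_eq h isOpen_Ioo (hu.mono Ioo_subset_Icc_self)
    (hv.mono Ioo_subset_Icc_self)).of_subset_closure hu hv Ioo_subset_Icc_self
    (closure_Ioo hT.ne).ge

theorem ae_timeMeasure_mem (T : ℝ) : ∀ᵐ t ∂(timeMeasure T), t ∈ Ioo 0 T :=
  ae_restrict_mem measurableSet_Ioo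

end TimeMeasure

section Volterra

variable {X Y : Type*} [NormedAddCommGroup X] [NormedSpace ℝ X] [NormedAddCommGroup Y]
  [NormedSpace ℝ Y] {T t : ℝ}

/-- The operator `w ↦ ∫₀ᵗ w` from `L²(0,T;X)` to `X`. -/
def primitive (T : ℝ) (X : Type*) [NormedAddCommGroup X] [NormedSpace ℝ X] (t : ℝ) :
    TimeL2 T X →L[ℝ] X :=
  LinearMap.mkContinuous
    { toFun := fun w => ∫ s in Iic t, w s ∂(timeMeasure T)
      map_add' := fun a b => by
        rw [← integral_add a.integrable.integrableOn b.integrable.integrableOn]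
        exact integral_congr_ae (ae_restrict_of_ae (Lp.coeFn_add a b))
      map_smul' := fun c a => by
        rw [RingHom.id_apply, ← integral_smul]
        exact integral_congr_ae (ae_restrict_of_ae (Lp.coeFn_smul c a)) }
    √T fun w => w.norm_setIntegral_le _

theorem primitive_eq (w : TimeL2 T X) (ht : t ∈ Icc 0 T) :
    primitive T X t w = ∫ s in (0 : ℝ)..t, w s :=
  setIntegral_Iic_timeMeasure _ ht

theorem primitive_zero (hT : 0 ≤ T) (w : TimeL2 T X) : primitive T X 0 w = 0 := by
  rw [primitive_eq w (left_mem_Icc.2 hT), intervalIntegral.integral_same]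

theorem norm_primitive_le (w : TimeL2 T X) (t : ℝ) : ‖primitive T X t w‖ ≤ √T * ‖w‖ :=
  w.norm_setIntegral_le _

theorem continuousOn_primitive (w : TimeL2 T X) :
    ContinuousOn (fun t => primitive T X t w) (Icc 0 T) := by
  rcases lt_or_ge T 0 with hT | hT
  · simp [Icc_eq_empty_of_lt hT]
  have hcont := intervalIntegral.continuousOn_primitive_interval ((intervalIntegrable_iff'
    (by simp)).1 (intervalIntegrable_of_integrable w.integrable (right_mem_Icc.2 hT)))
  rw [uIcc_of_le hT] at hcont
  exact hcont.congr fun t ht => primitive_eq w ht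

/-- The operator `w ↦ (t ↦ L (w t))` from `L²(0,T;X)` to `L²(0,T;Y)` induced by `L : X → Y`. -/
abbrev lift (T : ℝ) (L : X →L[ℝ] Y) : TimeL2 T X →L[ℝ] TimeL2 T Y :=
  L.compLpL 2 (timeMeasure T)

theorem primitive_lift [CompleteSpace X] [CompleteSpace Y] (L : X →L[ℝ] Y) (w : TimeL2 T X)
    (t : ℝ) : primitive T Y t (lift T L w) = L (primitive T X t w) := by
  change ∫ s in Iic t, (lift T L w) s ∂_ = L (∫ s in Iic t, w s ∂_)
  rw [← L.integral_comp_comm w.integrable.integrableOn]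
  exact integral_congr_ae (ae_restrict_of_ae (L.coeFn_compLpL w))

theorem eq_zero_of_primitive_eq_zero [CompleteSpace X] {w : TimeL2 T X}
    (h : ∀ t ∈ Icc 0 T, primitive T X t w = 0) : w = 0 := by
  rcases lt_or_ge T 0 with hT | hT
  · refine Lp.ext ?_
    simp [timeMeasure, Ioo_eq_empty_of_le hT.le, Filter.EventuallyEq]
  refine Lp.ext ?_
  have hw := intervalIntegrable_of_integrable w.integrable (right_mem_Icc.2 hT)
  filter_upwards [ae_restrict_of_ae hw.ae_hasDerivAt_integral, ae_timeMeasure_mem T,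
    Lp.coeFn_zero X 2 (timeMeasure T)] with t hderiv ht hzero
  rw [hzero]
  have ht' : t ∈ uIcc 0 T := by rw [uIcc_of_le hT]; exact Ioo_subset_Icc_self ht
  refine (hderiv ht' 0 left_mem_uIcc).unique
    ((hasDerivAt_const t (0 : X)).congr_of_eventuallyEq ?_)
  filter_upwards [Ioo_mem_nhds ht.1 ht.2] with s hs
  rw [← h s (Ioo_subset_Icc_self hs), primitive_eq w (Ioo_subset_Icc_self hs)]

/-- The Volterra operator `w ↦ ∫₀ w` on `L²(0,T;X)`, a right inverse of `d/dt` with zero initial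
values. -/
def volterra (T : ℝ) (X : Type*) [NormedAddCommGroup X] [NormedSpace ℝ X] :
    TimeL2 T X →L[ℝ] TimeL2 T X :=
  LinearMap.mkContinuous
    { toFun := fun w => (memLp_of_continuousOn (continuousOn_primitive w)).toLp _
      map_add' := fun a b => by
        rw [← MemLp.toLp_add]
        exact MemLp.toLp_congr _ _ (ae_of_all _ fun t => map_add (primitive T X t) a b)
      map_smul' := fun c a => by
        rw [RingHom.id_apply, ← MemLp.toLp_const_smul]
        exact MemLp.toLp_congr _ _ (ae_of_all _ fun t => map_smul (primitive T X t) c a) }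
    (√T * √T) fun w => by
      rw [mul_assoc]
      refine TimeL2.norm_le_of_ae_bound (by positivity) ?_
      filter_upwards [(memLp_of_continuousOn (continuousOn_primitive w)).coeFn_toLp] with t ht
      rw [LinearMap.coe_mk, AddHom.coe_mk, ht]
      exact norm_primitive_le w t

theorem coeFn_volterra (w : TimeL2 T X) :
    volterra T X w =ᵐ[timeMeasure T] fun t => primitive T X t w :=
  (memLp_of_continuousOn (continuousOn_primitive w)).coeFn_toLp

theorem volterra_injective [CompleteSpace X] (hT : 0 < T) {w : TimeL2 T X}
    (h : volterra T X w = 0) : w = 0 := by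
  refine eq_zero_of_primitive_eq_zero
    (eqOn_of_ae_eq hT (continuousOn_primitive w) continuousOn_const ?_)
  filter_upwards [coeFn_volterra w, Lp.coeFn_zero X 2 (timeMeasure T)] with t ht hzero
  rw [← ht, h, hzero, Pi.zero_apply]

theorem volterra_lift [CompleteSpace X] [CompleteSpace Y] (L : X →L[ℝ] Y) (w : TimeL2 T X) :
    volterra T Y (lift T L w) = lift T L (volterra T X w) := by
  refine Lp.ext ?_
  filter_upwards [coeFn_volterra (lift T L w), L.coeFn_compLpL (volterra T X w),
    coeFn_volterra w] with t hVL hLV hV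
  rw [hVL, hLV, hV, primitive_lift]

/-- Multiplication of a function of time by the indicator of the times up to `t`. -/
def cutoff (T : ℝ) (X : Type*) [NormedAddCommGroup X] [NormedSpace ℝ X] (t : ℝ) :
    TimeL2 T X →L[ℝ] TimeL2 T X :=
  LinearMap.mkContinuous
    { toFun := fun w => ((Lp.memLp w).indicator (measurableSet_Iic (a := t))).toLp _
      map_add' := fun a b => by
        rw [← MemLp.toLp_add]
        refine MemLp.toLp_congr _ _ ?_
        filter_upwards [Lp.coeFn_add a b] with s hs
        simp only [indicator_apply, Pi.add_apply, hs]
        split_ifs <;> simp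
      map_smul' := fun c a => by
        rw [RingHom.id_apply, ← MemLp.toLp_const_smul]
        refine MemLp.toLp_congr _ _ ?_
        filter_upwards [Lp.coeFn_smul c a] with s hs
        simp only [indicator_apply, Pi.smul_apply, hs]
        split_ifs <;> simp }
    1 fun w => by
      rw [one_mul]
      refine Lp.norm_le_norm_of_ae_le ?_
      filter_upwards [((Lp.memLp w).indicator (measurableSet_Iic (a := t))).coeFn_toLp] with s hs
      rw [LinearMap.coe_mk, AddHom.coe_mk, hs]
      exact norm_indicator_le_norm_self _ _

theorem coeFn_cutoff (t : ℝ) (w : TimeL2 T X) :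
    cutoff T X t w =ᵐ[timeMeasure T] (Iic t).indicator w :=
  ((Lp.memLp w).indicator (measurableSet_Iic (a := t))).coeFn_toLp

theorem norm_cutoff_le (t : ℝ) (w : TimeL2 T X) : ‖cutoff T X t w‖ ≤ ‖w‖ := by
  refine Lp.norm_le_norm_of_ae_le ?_
  filter_upwards [coeFn_cutoff t w] with s hs
  rw [hs]
  exact norm_indicator_le_norm_self _ _

theorem cutoff_self (w : TimeL2 T X) : cutoff T X T w = w := by
  refine Lp.ext ?_
  filter_upwards [coeFn_cutoff T w, ae_timeMeasure_mem T] with s hs hmem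
  rw [hs, indicator_of_mem (show s ∈ Iic T from hmem.2.le)]

theorem cutoff_lift (L : X →L[ℝ] Y) (t : ℝ) (w : TimeL2 T X) :
    cutoff T Y t (lift T L w) = lift T L (cutoff T X t w) := by
  refine Lp.ext ?_
  filter_upwards [coeFn_cutoff t (lift T L w), L.coeFn_compLpL (cutoff T X t w),
    coeFn_cutoff t w, L.coeFn_compLpL w] with s h₁ h₂ h₃ h₄
  simp only [h₁, h₂, h₃, h₄, indicator_apply]
  split_ifs <;> simp

end Volterra

section Energy

variable {X : Type*} [NormedAddCommGroup X] [InnerProductSpace ℝ X] {T t : ℝ}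

theorem inner_cutoff (t : ℝ) (a b : TimeL2 T X) :
    inner ℝ (cutoff T X t a) b = ∫ s in Iic t, inner ℝ (a s) (b s) ∂(timeMeasure T) := by
  rw [L2.inner_def, ← integral_indicator measurableSet_Iic]
  refine integral_congr_ae ?_
  filter_upwards [coeFn_cutoff t a] with s hs
  simp only [hs, indicator_apply]
  split_ifs <;> simp

theorem inner_cutoff_right (t : ℝ) (a b : TimeL2 T X) :
    inner ℝ a (cutoff T X t b) = inner ℝ (cutoff T X t a) b := by
  rw [real_inner_comm, inner_cutoff, inner_cutoff]
  simp_rw [real_inner_comm]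

theorem inner_cutoff_self_nonneg (t : ℝ) (a : TimeL2 T X) : 0 ≤ inner ℝ (cutoff T X t a) a := by
  rw [inner_cutoff]
  exact integral_nonneg fun s => real_inner_self_nonneg

theorem inner_lift_adjoint {Y : Type*} [NormedAddCommGroup Y] [InnerProductSpace ℝ Y]
    [CompleteSpace X] [CompleteSpace Y] (L : X →L[ℝ] Y) (a : TimeL2 T X) (b : TimeL2 T Y) :
    inner ℝ (lift T L.adjoint b) a = inner ℝ b (lift T L a) := by
  rw [L2.inner_def, L2.inner_def]
  refine integral_congr_ae ?_
  filter_upwards [L.coeFn_compLpL a, L.adjoint.coeFn_compLpL b] with s ha hb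
  rw [ha, hb, ContinuousLinearMap.adjoint_inner_left]

theorem inner_cutoff_volterra [CompleteSpace X] (w : TimeL2 T X) (ht : t ∈ Icc 0 T) :
    inner ℝ (cutoff T X t w) (volterra T X w) = 1 / 2 * ‖primitive T X t w‖ ^ 2 :=
  calc inner ℝ (cutoff T X t w) (volterra T X w)
      = ∫ s in Iic t, inner ℝ (w s) (primitive T X s w) ∂(timeMeasure T) := by
        rw [inner_cutoff]
        refine integral_congr_ae (ae_restrict_of_ae ?_)
        filter_upwards [coeFn_volterra w] with s hs
        rw [hs]
    _ = ∫ s in (0 : ℝ)..t, inner ℝ (w s) (∫ r in (0 : ℝ)..s, w r) := by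
        rw [setIntegral_Iic_timeMeasure _ ht]
        refine intervalIntegral.integral_congr fun s hs => ?_
        rw [uIcc_of_le ht.1] at hs
        rw [primitive_eq w ⟨hs.1, hs.2.trans ht.2⟩]
    _ = 1 / 2 * ‖primitive T X t w‖ ^ 2 := by
        rw [integral_inner_integral (intervalIntegrable_of_integrable w.integrable ht),
          primitive_eq w ht]

theorem inner_volterra_nonneg [CompleteSpace X] (hT : 0 ≤ T) (w : TimeL2 T X) :
    0 ≤ inner ℝ w (volterra T X w) := by
  have henergy := inner_cutoff_volterra w (right_mem_Icc.2 hT)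
  rw [cutoff_self] at henergy
  rw [henergy]
  positivity

end Energy

section Primitive

variable {X : Type*} [NormedAddCommGroup X] [NormedSpace ℝ X] {T s t : ℝ}
  {u u₁ u₂ w w₁ w₂ : ℝ → X}

theorem HasH1Deriv.integrable (h : HasH1Deriv T u w) : Integrable w (timeMeasure T) :=
  h.1.integrable (by norm_num)

theorem HasH1Deriv.norm_sub_le (h : HasH1Deriv T u w) (hs : s ∈ Icc 0 T) (ht : t ∈ Icc 0 T) :
    ‖u s - u t‖ ≤ |(∫ r in (0 : ℝ)..t, ‖w r‖) - ∫ r in (0 : ℝ)..s, ‖w r‖| := by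
  have hws := intervalIntegrable_of_integrable h.integrable hs
  have hwt := intervalIntegrable_of_integrable h.integrable ht
  rw [h.2 s hs, h.2 t ht, add_sub_add_left_eq_sub, norm_sub_rev,
    intervalIntegral.integral_interval_sub_left hwt hws,
    intervalIntegral.integral_interval_sub_left hwt.norm hws.norm]
  exact intervalIntegral.norm_integral_le_abs_integral_norm

theorem HasH1Deriv.sub (h₁ : HasH1Deriv T u₁ w₁) (h₂ : HasH1Deriv T u₂ w₂) :
    HasH1Deriv T (fun t => u₁ t - u₂ t) fun t => w₁ t - w₂ t := by
  refine ⟨h₁.1.sub h₂.1, fun t ht => ?_⟩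
  beta_reduce
  rw [intervalIntegral.integral_sub (intervalIntegrable_of_integrable h₁.integrable ht)
    (intervalIntegrable_of_integrable h₂.integrable ht), h₁.2 t ht, h₂.2 t ht, add_sub_add_comm]

theorem HasH1Deriv.clm_comp [CompleteSpace X] {Y : Type*} [NormedAddCommGroup Y]
    [NormedSpace ℝ Y] [CompleteSpace Y] (h : HasH1Deriv T u w) (L : X →L[ℝ] Y) :
    HasH1Deriv T (fun t => L (u t)) fun t => L (w t) := by
  refine ⟨L.comp_memLp' h.1, fun t ht => ?_⟩
  beta_reduce
  rw [L.intervalIntegral_comp_comm (intervalIntegrable_of_integrable h.integrable ht), ← map_add,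
    ← h.2 t ht]

end Primitive

section PrimitiveToLp

variable {X : Type*} [NormedAddCommGroup X] [InnerProductSpace ℝ X] {T t : ℝ} {a : X} {u w : ℝ → X}

theorem primitive_toLp (hw : MemLp w 2 (timeMeasure T)) (ht : t ∈ Icc 0 T) :
    primitive T X t (hw.toLp w) = ∫ s in (0 : ℝ)..t, w s := by
  rw [← setIntegral_Iic_timeMeasure _ ht]
  exact integral_congr_ae (ae_restrict_of_ae hw.coeFn_toLp)

theorem HasH1Deriv.eq_add_primitive (h : HasH1Deriv T u w) (ha : u 0 = a) (ht : t ∈ Icc 0 T) :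
    u t = a + primitive T X t (h.1.toLp w) := by
  rw [primitive_toLp h.1 ht, ← ha]
  exact h.2 t ht

end PrimitiveToLp

/-! ## Weak convergence and monotone operators -/

section WeakConvergence

variable {E F : Type*} [NormedAddCommGroup E] [InnerProductSpace ℝ E] [NormedAddCommGroup F]
  [InnerProductSpace ℝ F] {ι : Type*}

/-- Weak convergence in an inner product space along a filter. -/
def WeakTendsto (u : ι → E) (l : Filter ι) (x : E) : Prop :=
  ∀ z, Tendsto (fun n => inner ℝ z (u n)) l (𝓝 (inner ℝ z x))

theorem exists_weakTendsto [CompleteSpace E] (U : Ultrafilter ι) {u : ι → E} {C : ℝ}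
    (hu : ∀ n, ‖u n‖ ≤ C) : ∃ x, ‖x‖ ≤ C ∧ WeakTendsto u U x := by
  let toDual := InnerProductSpace.toDual ℝ E
  obtain ⟨ℓ, hℓ, hlim⟩ := (WeakDual.isCompact_closedBall (0 : StrongDual ℝ E) C).ultrafilter_le_nhds
    (U.map fun n => StrongDual.toWeakDual (toDual (u n))) (by
      rw [le_principal_iff, Ultrafilter.mem_coe, Ultrafilter.mem_map]
      exact Filter.univ_mem' fun n => by simpa using hu n)
  refine ⟨toDual.symm (WeakDual.toStrongDual ℓ), by simpa using hℓ, fun z => ?_⟩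
  rw [real_inner_comm, InnerProductSpace.toDual_symm_apply]
  refine (((WeakDual.eval_continuous z).tendsto ℓ).comp hlim).congr fun n => ?_
  exact real_inner_comm z (u n)

namespace WeakTendsto

variable {u v : ι → E} {l : Filter ι} {x y : E}

theorem map [CompleteSpace E] [CompleteSpace F] (h : WeakTendsto u l x) (L : E →L[ℝ] F) :
    WeakTendsto (fun n => L (u n)) l (L x) := fun z => by
  simpa only [ContinuousLinearMap.adjoint_inner_left] using h (L.adjoint z)

theorem add (h : WeakTendsto u l x) (h' : WeakTendsto v l y) :
    WeakTendsto (fun n => u n + v n) l (x + y) := fun z => by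
  simpa only [inner_add_right] using (h z).add (h' z)

theorem const_add (a : E) (h : WeakTendsto u l x) : WeakTendsto (fun n => a + u n) l (a + x) :=
  add (fun _ => tendsto_const_nhds) h

theorem const_sub (a : E) (h : WeakTendsto u l x) :
    WeakTendsto (fun n => a - u n) l (a - x) := fun z => by
  simpa only [inner_sub_right] using (h z).const_sub (inner ℝ z a)

theorem smul_zero (h : WeakTendsto u l x) {c : ι → ℝ} (hc : Tendsto c l (𝓝 0)) :
    WeakTendsto (fun n => c n • u n) l 0 := fun z => by
  simpa only [inner_smul_right, zero_mul, inner_zero_right] using hc.mul (h z)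

theorem unique [l.NeBot] (h : WeakTendsto u l x) (h' : WeakTendsto u l y) : x = y :=
  ext_inner_left ℝ fun z => tendsto_nhds_unique (h z) (h' z)

theorem mem [CompleteSpace E] [l.NeBot] (h : WeakTendsto u l x) {K : Set E} (hcl : IsClosed K)
    (hcv : Convex ℝ K) (hu : ∀ n, u n ∈ K) : x ∈ K := by
  obtain ⟨n⟩ : Nonempty ι := l.nonempty_of_neBot
  obtain ⟨p, hp, hpx⟩ :=
    exists_norm_eq_iInf_of_complete_convex ⟨u n, hu n⟩ hcl.isComplete hcv x
  rw [norm_eq_iInf_iff_real_inner_le_zero hcv hp] at hpx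
  have hlim : Tendsto (fun n => inner ℝ (x - p) (u n - p)) l (𝓝 (inner ℝ (x - p) (x - p))) := by
    simpa only [inner_sub_right] using (h (x - p)).sub_const (inner ℝ (x - p) p)
  have hzero := le_of_tendsto hlim (Eventually.of_forall fun n => hpx _ (hu n))
  rw [real_inner_self_nonpos, sub_eq_zero] at hzero
  rwa [hzero]

/-- Weak lower semicontinuity of `u ↦ ⟪A u, u⟫`, witnessed by its affine minorant at `x`. -/
theorem exists_minorant [CompleteSpace E] (h : WeakTendsto u l x) {A : E →L[ℝ] E}
    (hA : ∀ z, 0 ≤ inner ℝ (A z) z) :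
    ∃ m : ι → ℝ, (∀ n, m n ≤ inner ℝ (A (u n)) (u n)) ∧
      Tendsto m l (𝓝 (inner ℝ (A x) x)) := by
  refine ⟨fun n => inner ℝ (A x) (u n) + inner ℝ x (A (u n)) - inner ℝ (A x) x, fun n => ?_, ?_⟩
  · have hmono := hA (u n - x)
    simp only [map_sub, inner_sub_left, inner_sub_right] at hmono
    linarith [real_inner_comm x (A (u n))]
  · have hlim := ((h (A x)).add (h.map A x)).sub_const (inner ℝ (A x) x)
    rwa [real_inner_comm (A x) x, add_sub_cancel_right] at hlim

end WeakTendsto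

end WeakConvergence

section CoerciveOperators

variable {E : Type*} [NormedAddCommGroup E] [InnerProductSpace ℝ E] {c : ℝ}

theorem norm_sub_le_of_inner_le_zero {x y p q : E} (hp : inner ℝ (x - p) (q - p) ≤ 0)
    (hq : inner ℝ (y - q) (p - q) ≤ 0) : ‖p - q‖ ≤ ‖x - y‖ := by
  have hinner : ‖p - q‖ ^ 2 ≤ inner ℝ (x - y) (p - q) := by
    rw [← real_inner_self_eq_norm_sq]
    simp only [inner_sub_left, inner_sub_right] at hp hq ⊢
    linarith
  have hCS := real_inner_le_norm (x - y) (p - q)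
  nlinarith [norm_nonneg (x - y), norm_nonneg (p - q)]

theorem norm_le_of_apply_add_smul_eq {V : E →L[ℝ] E} (hV : ∀ z, 0 ≤ inner ℝ z (V z)) (hc : 0 < c)
    {p q : E} (h : V p + c • p = V q) : ‖p‖ ≤ ‖q‖ := by
  have hdiff : V (p - q) = -(c • p) := by
    rw [map_sub, ← h]; abel
  have hinner : inner ℝ (p - q) p ≤ 0 := by
    have hmono := hV (p - q)
    rw [hdiff, inner_neg_right, real_inner_smul_right, neg_nonneg] at hmono
    exact nonpos_of_mul_nonpos_right hmono hc
  rw [inner_sub_left, real_inner_self_eq_norm_sq] at hinner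
  nlinarith [real_inner_le_norm q p, norm_nonneg p, norm_nonneg q]

theorem exists_norm_sub_smul_le (B : E →L[ℝ] E) (hc : 0 < c)
    (hB : ∀ z, c * ‖z‖ ^ 2 ≤ inner ℝ (B z) z) :
    ∃ r > (0 : ℝ), ∃ k : NNReal, k < 1 ∧ ∀ z, ‖z - r • B z‖ ≤ k * ‖z‖ := by
  set M : ℝ := ‖B‖ + 1
  have hM : 0 < M := by positivity
  have hBz : ∀ z, ‖B z‖ ^ 2 ≤ M ^ 2 * ‖z‖ ^ 2 := fun z => by
    rw [← mul_pow]
    exact pow_le_pow_left₀ (norm_nonneg _)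
      (B.le_of_opNorm_le (le_add_of_nonneg_right zero_le_one) z) 2
  refine ⟨c / M ^ 2, by positivity, (√(1 - c ^ 2 / M ^ 2)).toNNReal, ?_, fun z => ?_⟩
  · rw [Real.toNNReal_lt_one, Real.sqrt_lt' one_pos]
    have : 0 < c ^ 2 / M ^ 2 := by positivity
    linarith
  have hsq : ‖z - (c / M ^ 2) • B z‖ ^ 2 ≤ (1 - c ^ 2 / M ^ 2) * ‖z‖ ^ 2 :=
    calc ‖z - (c / M ^ 2) • B z‖ ^ 2
        = ‖z‖ ^ 2 - 2 * (c / M ^ 2 * inner ℝ (B z) z) + (c / M ^ 2) ^ 2 * ‖B z‖ ^ 2 := by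
          rw [norm_sub_sq_real, inner_smul_right, norm_smul, mul_pow, Real.norm_eq_abs, sq_abs,
            real_inner_comm]
      _ ≤ ‖z‖ ^ 2 - 2 * (c / M ^ 2 * (c * ‖z‖ ^ 2)) + (c / M ^ 2) ^ 2 * (M ^ 2 * ‖z‖ ^ 2) := by
          gcongr
          exacts [hB z, hBz z]
      _ = (1 - c ^ 2 / M ^ 2) * ‖z‖ ^ 2 := by field_simp; ring
  rw [Real.coe_toNNReal _ (Real.sqrt_nonneg _), ← Real.sqrt_sq (norm_nonneg z),
    ← Real.sqrt_mul' _ (sq_nonneg _)]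
  exact Real.le_sqrt_of_sq_le hsq

variable [CompleteSpace E]

/-- The Lions–Stampacchia theorem: `x` is a fixed point of `x ↦ P (x - r (B x - f))`, where `P` is
the metric projection on `K`. -/
theorem exists_variationalInequality (B : E →L[ℝ] E) (hc : 0 < c)
    (hB : ∀ z, c * ‖z‖ ^ 2 ≤ inner ℝ (B z) z) {K : Set E} (hne : K.Nonempty) (hcl : IsClosed K)
    (hcv : Convex ℝ K) (f : E) : ∃ x ∈ K, ∀ z ∈ K, inner ℝ (B x - f) (x - z) ≤ 0 := by
  have hproj : ∀ x : E, ∃ p ∈ K, ∀ z ∈ K, inner ℝ (x - p) (z - p) ≤ 0 := fun x => by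
    obtain ⟨p, hp, hpx⟩ := exists_norm_eq_iInf_of_complete_convex hne hcl.isComplete hcv x
    exact ⟨p, hp, (norm_eq_iInf_iff_real_inner_le_zero hcv hp).1 hpx⟩
  choose P hPmem hP using hproj
  obtain ⟨r, hr, k, hk, hcontr⟩ := exists_norm_sub_smul_le B hc hB
  have hfix : ContractingWith k fun x => P (x - r • (B x - f)) := by
    refine ⟨hk, LipschitzWith.of_dist_le_mul fun x y => ?_⟩
    rw [dist_eq_norm, dist_eq_norm]
    refine (norm_sub_le_of_inner_le_zero (hP _ _ (hPmem _)) (hP _ _ (hPmem _))).trans ?_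
    have hsub : x - r • (B x - f) - (y - r • (B y - f)) = (x - y) - r • B (x - y) := by
      rw [map_sub]; module
    rw [hsub]
    exact hcontr _
  obtain ⟨x, hx⟩ : ∃ x, P (x - r • (B x - f)) = x := ⟨_, hfix.fixedPoint_isFixedPt⟩
  refine ⟨x, hx ▸ hPmem _, fun z hz => ?_⟩
  have hvi := hP (x - r • (B x - f)) z hz
  have hflip : inner ℝ (-(r • (B x - f))) (z - x) = r * inner ℝ (B x - f) (x - z) := by
    rw [← neg_sub x z, inner_neg_neg, real_inner_smul_left]
  rw [hx, sub_sub_cancel_left, hflip] at hvi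
  exact nonpos_of_mul_nonpos_right hvi hr

theorem exists_rightInverse_of_coercive (B : E →L[ℝ] E) (hc : 0 < c)
    (hB : ∀ z, c * ‖z‖ ^ 2 ≤ inner ℝ (B z) z) : ∃ R : E →L[ℝ] E, ∀ x, B (R x) = x := by
  have hcoercive : IsCoercive ((innerSL ℝ).comp B : E →L[ℝ] E →L[ℝ] ℝ) :=
    ⟨c, hc, fun z => by simpa [mul_assoc, sq] using hB z⟩
  refine ⟨hcoercive.continuousLinearEquivOfBilin.symm, fun x => ext_inner_right ℝ fun z => ?_⟩
  have hbilin := hcoercive.continuousLinearEquivOfBilin_apply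
    (hcoercive.continuousLinearEquivOfBilin.symm x) z
  simpa using hbilin.symm

theorem exists_resolvent {V : E →L[ℝ] E} (hV : ∀ z, 0 ≤ inner ℝ z (V z)) (hc : 0 < c) :
    ∃ R : E →L[ℝ] E, (∀ x, V (R x) + c • R x = x) ∧
      ∃ k > 0, ∀ x, k * ‖x‖ ^ 2 ≤ inner ℝ (R x) x := by
  have hinner : ∀ z, c * ‖z‖ ^ 2 ≤ inner ℝ z (V z + c • z) := fun z => by
    rw [inner_add_right, inner_smul_right, real_inner_self_eq_norm_sq]
    linarith [hV z]
  obtain ⟨R, hR⟩ := exists_rightInverse_of_coercive (V + c • ContinuousLinearMap.id ℝ E) hc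
    fun z => by simpa [real_inner_comm z] using hinner z
  simp only [_root_.add_apply, _root_.smul_apply, ContinuousLinearMap.id_apply] at hR
  refine ⟨R, hR, c / (‖V‖ + c) ^ 2, by positivity, fun x => ?_⟩
  have hnorm : ‖x‖ ≤ (‖V‖ + c) * ‖R x‖ :=
    calc ‖x‖ = ‖V (R x) + c • R x‖ := by rw [hR]
      _ ≤ ‖V‖ * ‖R x‖ + c * ‖R x‖ := by
        refine (norm_add_le _ _).trans (add_le_add (V.le_opNorm _) ?_)
        rw [norm_smul, Real.norm_of_nonneg hc.le]
      _ = (‖V‖ + c) * ‖R x‖ := by ring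
  calc c / (‖V‖ + c) ^ 2 * ‖x‖ ^ 2 ≤ c / (‖V‖ + c) ^ 2 * ((‖V‖ + c) * ‖R x‖) ^ 2 := by gcongr
    _ = c * ‖R x‖ ^ 2 := by field_simp
    _ ≤ inner ℝ (R x) x := by simpa only [hR] using hinner (R x)

end CoerciveOperators

/-! ## Relaxed trajectories -/

section Trajectory

variable {X : Type*} [NormedAddCommGroup X] [InnerProductSpace ℝ X] {T t : ℝ}

/-- The function `t ↦ a + ∫₀ᵗ w` as an element of `L²(0,T;X)`. -/
def trajectory (a : X) (w : TimeL2 T X) : TimeL2 T X :=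
  Lp.const 2 (timeMeasure T) a + volterra T X w

theorem coeFn_trajectory (a : X) (w : TimeL2 T X) :
    trajectory a w =ᵐ[timeMeasure T] fun t => a + primitive T X t w := by
  filter_upwards [Lp.coeFn_add (Lp.const 2 (timeMeasure T) a) (volterra T X w), coeFn_volterra w,
    Lp.coeFn_const (p := 2) (μ := timeMeasure T) a] with t hadd hvolterra hconst
  rw [trajectory, hadd, Pi.add_apply, hvolterra, hconst, Function.const_apply]

theorem trajectory_zero (w : TimeL2 T X) : trajectory 0 w = volterra T X w := by
  rw [trajectory, map_zero, zero_add]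

theorem trajectory_sub (a b : X) (w z : TimeL2 T X) :
    trajectory a w - trajectory b z = trajectory (a - b) (w - z) := by
  simp only [trajectory, map_sub]
  abel

theorem continuousOn_const_add_primitive (a : X) (w : TimeL2 T X) :
    ContinuousOn (fun t => a + primitive T X t w) (Icc 0 T) :=
  continuousOn_const.add (continuousOn_primitive w)

theorem inner_cutoff_const [CompleteSpace X] (w : TimeL2 T X) (a : X) (t : ℝ) :
    inner ℝ (cutoff T X t w) (Lp.const 2 (timeMeasure T) a) = inner ℝ (primitive T X t w) a := by
  rw [inner_cutoff, real_inner_comm]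
  refine Eq.trans ?_ (integral_inner w.integrable.integrableOn a)
  refine integral_congr_ae (ae_restrict_of_ae ?_)
  filter_upwards [Lp.coeFn_const (p := 2) (μ := timeMeasure T) a] with s hs
  rw [hs, Function.const_apply, real_inner_comm]

theorem inner_cutoff_trajectory [CompleteSpace X] (a : X) (w : TimeL2 T X) (ht : t ∈ Icc 0 T) :
    inner ℝ (cutoff T X t w) (trajectory a w)
      = 1 / 2 * (‖a + primitive T X t w‖ ^ 2 - ‖a‖ ^ 2) := by
  rw [trajectory, inner_add_right, inner_cutoff_const, inner_cutoff_volterra w ht,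
    norm_add_sq_real, real_inner_comm]
  ring

theorem norm_trajectory_add_smul_sq_le (hT : 0 ≤ T) {a : X} {w : TimeL2 T X} {c b : ℝ}
    (hc : c ∈ Ioo 0 1) (henergy : ∀ t ∈ Icc 0 T,
      ‖a + primitive T X t w‖ ^ 2 + 2 * (c * inner ℝ (cutoff T X t w) w) ≤ b) :
    ‖trajectory a w + c • w‖ ^ 2 ≤ (2 * T + 1) * b := by
  have hpos : ∀ t, 0 ≤ 2 * (c * inner ℝ (cutoff T X t w) w) := fun t =>
    mul_nonneg zero_le_two (mul_nonneg hc.1.le (inner_cutoff_self_nonneg t w))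
  have hpoint : ∀ t ∈ Icc 0 T, ‖a + primitive T X t w‖ ^ 2 ≤ b := fun t ht =>
    (le_add_of_nonneg_right (hpos t)).trans (henergy t ht)
  have hb : 0 ≤ b := (sq_nonneg _).trans (hpoint 0 (left_mem_Icc.2 hT))
  have htraj : ‖trajectory a w‖ ^ 2 ≤ T * b := by
    have hbound : ‖trajectory a w‖ ≤ √T * √b := by
      refine TimeL2.norm_le_of_ae_bound (Real.sqrt_nonneg _) ?_
      filter_upwards [coeFn_trajectory a w, ae_timeMeasure_mem T] with t ht hmem
      rw [ht]
      exact Real.le_sqrt_of_sq_le (hpoint t (Ioo_subset_Icc_self hmem))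
    calc ‖trajectory a w‖ ^ 2 ≤ (√T * √b) ^ 2 := pow_le_pow_left₀ (norm_nonneg _) hbound 2
      _ = T * b := by rw [mul_pow, Real.sq_sqrt hT, Real.sq_sqrt hb]
  have hrelax : 2 * ‖c • w‖ ^ 2 ≤ b := by
    have hfinal := henergy T (right_mem_Icc.2 hT)
    rw [cutoff_self, real_inner_self_eq_norm_sq] at hfinal
    calc 2 * ‖c • w‖ ^ 2 = c * (2 * (c * ‖w‖ ^ 2)) := by
          rw [norm_smul, Real.norm_of_nonneg hc.1.le]; ring
      _ ≤ 2 * (c * ‖w‖ ^ 2) := mul_le_of_le_one_left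
          (mul_nonneg zero_le_two (mul_nonneg hc.1.le (sq_nonneg _))) hc.2.le
      _ ≤ b := by linarith [sq_nonneg ‖a + primitive T X T w‖]
  calc ‖trajectory a w + c • w‖ ^ 2 ≤ (‖trajectory a w‖ + ‖c • w‖) ^ 2 :=
        pow_le_pow_left₀ (norm_nonneg _) (norm_add_le _ _) 2
    _ ≤ 2 * (‖trajectory a w‖ ^ 2 + ‖c • w‖ ^ 2) := add_sq_le
    _ ≤ (2 * T + 1) * b := by linarith

/-- An operator `A` on `L²(0,T;X)` that is monotone on every initial time interval:
`∫₀ᵗ ⟪x, A x⟫ ≥ 0`. -/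
def IsCausallyMonotone (A : TimeL2 T X →L[ℝ] TimeL2 T X) : Prop :=
  ∀ t ∈ Icc 0 T, ∀ x, 0 ≤ inner ℝ (cutoff T X t x) (A x)

theorem IsCausallyMonotone.inner_nonneg {A : TimeL2 T X →L[ℝ] TimeL2 T X}
    (hA : IsCausallyMonotone A) (hT : 0 ≤ T) (x : TimeL2 T X) : 0 ≤ inner ℝ (A x) x := by
  simpa only [cutoff_self, real_inner_comm] using hA T (right_mem_Icc.2 hT) x

theorem IsCausallyMonotone.conj [CompleteSpace X] {Y : Type*} [NormedAddCommGroup Y]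
    [InnerProductSpace ℝ Y] [CompleteSpace Y] {A : TimeL2 T X →L[ℝ] TimeL2 T X}
    (hA : IsCausallyMonotone A) (L : X →L[ℝ] Y) :
    IsCausallyMonotone (lift T L ∘L A ∘L lift T L.adjoint) := fun t ht x => by
  rw [ContinuousLinearMap.comp_apply, ContinuousLinearMap.comp_apply, ← inner_lift_adjoint,
    ← cutoff_lift]
  exact hA t ht _

variable {a : X} {u w : ℝ → X}

theorem HasH1Deriv.coeFn_trajectory (h : HasH1Deriv T u w) (ha : u 0 = a) :
    trajectory a (h.1.toLp w) =ᵐ[timeMeasure T] u := by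
  filter_upwards [ViscousPlasticity.coeFn_trajectory a (h.1.toLp w), ae_timeMeasure_mem T]
    with t htraj ht
  rw [htraj, ← h.eq_add_primitive ha (Ioo_subset_Icc_self ht)]

theorem HasH1Deriv.memLp (h : HasH1Deriv T u w) : MemLp u 2 (timeMeasure T) :=
  (memLp_congr_ae (h.coeFn_trajectory rfl)).1 (Lp.memLp _)

theorem hasH1Deriv_of_eq_add_primitive (hT : 0 ≤ T) {w : TimeL2 T X}
    (h : ∀ t ∈ Icc 0 T, u t = a + primitive T X t w) : HasH1Deriv T u w := by
  refine ⟨Lp.memLp w, fun t ht => ?_⟩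
  rw [h t ht, h 0 (left_mem_Icc.2 hT), primitive_zero hT, add_zero, primitive_eq w ht]

end Trajectory

/-! ## The linear parabolic equation -/

section Parabolic

variable {V H W : Type*} [NormedAddCommGroup V] [InnerProductSpace ℝ V]
  [NormedAddCommGroup H] [InnerProductSpace ℝ H] [NormedAddCommGroup W] [InnerProductSpace ℝ W]
  {T : ℝ}

/-- The norm of `V` is the graph norm of the unbounded operator that `i : V → H` and `D : V → W`
represent. -/
def IsGraphNorm (i : V →L[ℝ] H) (D : V →L[ℝ] W) : Prop :=
  ∀ z, ‖z‖ ^ 2 = ‖i z‖ ^ 2 + ‖D z‖ ^ 2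

theorem IsGraphNorm.lift {i : V →L[ℝ] H} {D : V →L[ℝ] W} (hnorm : IsGraphNorm i D) :
    IsGraphNorm (lift T i) (lift T D) := fun u => by
  rw [← real_inner_self_eq_norm_sq, ← real_inner_self_eq_norm_sq, ← real_inner_self_eq_norm_sq,
    L2.inner_def, L2.inner_def, L2.inner_def,
    ← integral_add (L2.integrable_inner _ _) (L2.integrable_inner _ _)]
  refine integral_congr_ae ?_
  filter_upwards [i.coeFn_compLpL u, D.coeFn_compLpL u] with t hi hD
  rw [hi, hD, real_inner_self_eq_norm_sq, real_inner_self_eq_norm_sq, real_inner_self_eq_norm_sq,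
    hnorm]

variable [CompleteSpace V] [CompleteSpace H] [CompleteSpace W]

/-- `u ∈ L²(0,T;V)` solves `u' + ν D*D u = F`, `u(0) = 0`, integrated in time. Functionals on `V`
are represented by elements of `V`. -/
def IsParabolicSol (i : V →L[ℝ] H) (D : V →L[ℝ] W) (ν : ℝ) (F u : TimeL2 T V) : Prop :=
  lift T i.adjoint (lift T i u) = volterra T V (F - ν • lift T D.adjoint (lift T D u))

variable {i : V →L[ℝ] H} {D : V →L[ℝ] W} {ν c t : ℝ} {F F' u u' : TimeL2 T V} {w : TimeL2 T H}

theorem IsParabolicSol.add (h : IsParabolicSol i D ν F u) (h' : IsParabolicSol i D ν F' u') :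
    IsParabolicSol i D ν (F + F') (u + u') := by
  unfold IsParabolicSol at *
  simp only [map_add, map_sub, map_smul, smul_add] at *
  rw [h, h']
  abel

theorem IsParabolicSol.smul (a : ℝ) (h : IsParabolicSol i D ν F u) :
    IsParabolicSol i D ν (a • F) (a • u) := by
  unfold IsParabolicSol at *
  simp only [map_sub, map_smul] at *
  rw [h, smul_sub, smul_comm a ν]

theorem IsParabolicSol.eq_zero (hT : 0 < T) (hν : 0 < ν) (hnorm : IsGraphNorm i D)
    (h : IsParabolicSol i D ν 0 u) : u = 0 := by
  rw [IsParabolicSol, zero_sub, map_neg, map_smul] at h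
  have henergy : ‖lift T i u‖ ^ 2
      = -(ν * inner ℝ (lift T D u) (volterra T W (lift T D u))) := by
    rw [← real_inner_self_eq_norm_sq, ← inner_lift_adjoint, h, volterra_lift, inner_neg_left,
      real_inner_smul_left, inner_lift_adjoint, real_inner_comm]
  have hi : lift T i u = 0 := by
    rw [← norm_eq_zero, ← sq_eq_zero_iff]
    linarith [sq_nonneg ‖lift T i u‖, mul_nonneg hν.le (inner_volterra_nonneg hT.le (lift T D u))]
  rw [hi, map_zero, eq_comm, neg_eq_zero, smul_eq_zero_iff_right hν.ne'] at h
  have hD : lift T D u = 0 := by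
    rw [← inner_self_eq_zero (𝕜 := ℝ), ← inner_lift_adjoint, volterra_injective hT h,
      inner_zero_left]
  rw [← norm_eq_zero, ← sq_eq_zero_iff, hnorm.lift u, hi, hD]
  simp

theorem IsParabolicSol.unique (hT : 0 < T) (hν : 0 < ν) (hnorm : IsGraphNorm i D)
    (h : IsParabolicSol i D ν F u) (h' : IsParabolicSol i D ν F u') : u = u' := by
  have hdiff := h.add (h'.smul (-1))
  rw [neg_one_smul, neg_one_smul, ← sub_eq_add_neg, ← sub_eq_add_neg, sub_self] at hdiff
  exact sub_eq_zero.1 (hdiff.eq_zero hT hν hnorm)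

/-- The parabolic equation with the time derivative replaced by its Yosida approximation
`w = (volterra + c)⁻¹ (i u)`. -/
structure IsRegularizedParabolicSol (i : V →L[ℝ] H) (D : V →L[ℝ] W) (ν c : ℝ)
    (F u : TimeL2 T V) (w : TimeL2 T H) : Prop where
  position : lift T i u = volterra T H w + c • w
  balance : lift T i.adjoint w + ν • lift T D.adjoint (lift T D u) = F

theorem exists_isRegularizedParabolicSol (hT : 0 ≤ T) (hν : 0 < ν) (hnorm : IsGraphNorm i D)
    (hc : 0 < c) (F : TimeL2 T V) : ∃ u w, IsRegularizedParabolicSol i D ν c F u w := by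
  obtain ⟨R, hR, k, hk, hRk⟩ := exists_resolvent (inner_volterra_nonneg (X := H) hT) hc
  obtain ⟨S, hS⟩ := exists_rightInverse_of_coercive
    (lift T i.adjoint ∘L R ∘L lift T i + ν • (lift T D.adjoint ∘L lift T D))
    (lt_min hk hν) fun z => by
      simp only [_root_.add_apply, _root_.smul_apply, ContinuousLinearMap.comp_apply,
        inner_add_left, real_inner_smul_left]
      rw [inner_lift_adjoint, inner_lift_adjoint, real_inner_self_eq_norm_sq, hnorm.lift z, mul_add]
      gcongr
      · exact (mul_le_mul_of_nonneg_right (min_le_left _ _) (sq_nonneg _)).trans (hRk _)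
      · exact min_le_right _ _
  exact ⟨S F, R (lift T i (S F)), (hR _).symm, by simpa using hS F⟩

namespace IsRegularizedParabolicSol

theorem energy (h : IsRegularizedParabolicSol i D ν c F u w) (ht : t ∈ Icc 0 T) :
    1 / 2 * ‖primitive T H t w‖ ^ 2 + c * inner ℝ (cutoff T H t w) w
      + ν * inner ℝ (cutoff T W t (lift T D u)) (lift T D u) = inner ℝ (cutoff T V t F) u := by
  rw [← inner_cutoff_right t F u, ← h.balance, inner_add_left, real_inner_smul_left,
    inner_lift_adjoint, inner_lift_adjoint, ← cutoff_lift, ← cutoff_lift, inner_cutoff_right,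
    inner_cutoff_right, h.position, inner_add_right, inner_cutoff_volterra w ht, inner_smul_right]

theorem energy_le (hν : 0 < ν) (h : IsRegularizedParabolicSol i D ν c F u w)
    (ht : t ∈ Icc 0 T) :
    ‖0 + primitive T H t w‖ ^ 2 + 2 * (c * inner ℝ (cutoff T H t w) w) ≤ 2 * (‖F‖ * ‖u‖) := by
  have hF : inner ℝ (cutoff T V t F) u ≤ ‖F‖ * ‖u‖ := (real_inner_le_norm _ _).trans
    (mul_le_mul_of_nonneg_right (norm_cutoff_le t F) (norm_nonneg u))
  rw [zero_add]
  linarith [h.energy ht, mul_nonneg hν.le (inner_cutoff_self_nonneg t (lift T D u))]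

theorem norm_le (hT : 0 ≤ T) (hν : 0 < ν) (hnorm : IsGraphNorm i D) (hc : c ∈ Ioo 0 1)
    (h : IsRegularizedParabolicSol i D ν c F u w) : ‖u‖ ≤ (4 * T + 2 + 1 / ν) * ‖F‖ := by
  have hi : ‖lift T i u‖ ^ 2 ≤ (2 * T + 1) * (2 * (‖F‖ * ‖u‖)) := by
    rw [h.position, ← trajectory_zero]
    exact norm_trajectory_add_smul_sq_le hT hc fun t ht => h.energy_le hν ht
  have hD : ‖lift T D u‖ ^ 2 ≤ 1 / ν * (‖F‖ * ‖u‖) := by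
    have hfinal := h.energy (right_mem_Icc.2 hT)
    rw [cutoff_self, cutoff_self, cutoff_self, real_inner_self_eq_norm_sq,
      real_inner_self_eq_norm_sq] at hfinal
    rw [one_div_mul_eq_div, le_div_iff₀' hν]
    linarith [sq_nonneg ‖primitive T H T w‖, mul_nonneg hc.1.le (sq_nonneg ‖w‖),
      real_inner_le_norm F u]
  have hu : ‖u‖ * ‖u‖ ≤ (4 * T + 2 + 1 / ν) * ‖F‖ * ‖u‖ := by
    rw [← sq, hnorm.lift u]
    linarith
  rcases (norm_nonneg u).eq_or_lt with hzero | hpos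
  · rw [← hzero]; positivity
  · exact le_of_mul_le_mul_right hu hpos

theorem norm_primitive_le (hT : 0 ≤ T) (hν : 0 < ν) (hnorm : IsGraphNorm i D) (hc : c ∈ Ioo 0 1)
    (h : IsRegularizedParabolicSol i D ν c F u w) (ht : t ∈ Icc 0 T) :
    ‖primitive T H t w‖ ≤ (4 * T + 2 + 1 / ν) * ‖F‖ := by
  refine le_of_sq_le_sq ?_ (by positivity)
  have hpos := mul_nonneg hc.1.le (inner_cutoff_self_nonneg t w)
  have henergy := h.energy_le hν ht
  rw [zero_add] at henergy
  have htwo : 2 ≤ 4 * T + 2 + 1 / ν := by linarith [one_div_pos.2 hν]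
  calc ‖primitive T H t w‖ ^ 2 ≤ 2 * (‖F‖ * ‖u‖) := by linarith
    _ ≤ 2 * (‖F‖ * ((4 * T + 2 + 1 / ν) * ‖F‖)) := by
        gcongr
        exact h.norm_le hT hν hnorm hc
    _ ≤ (4 * T + 2 + 1 / ν) * (‖F‖ * ((4 * T + 2 + 1 / ν) * ‖F‖)) := by gcongr
    _ = ((4 * T + 2 + 1 / ν) * ‖F‖) ^ 2 := by ring

end IsRegularizedParabolicSol

theorem exists_isParabolicSol (hT : 0 < T) (hν : 0 < ν) (hnorm : IsGraphNorm i D)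
    (F : TimeL2 T V) : ∃ u, IsParabolicSol i D ν F u ∧ ‖u‖ ≤ (4 * T + 2 + 1 / ν) * ‖F‖ ∧
      (∀ t ∈ Icc 0 T, 0 ≤ inner ℝ (cutoff T V t F) u) ∧
      ∀ t ∈ Icc 0 T, ∃ v : H, ‖v‖ ≤ (4 * T + 2 + 1 / ν) * ‖F‖ ∧
        i.adjoint v = primitive T V t (F - ν • lift T D.adjoint (lift T D u)) := by
  obtain ⟨c, -, hc, hc0⟩ := exists_seq_strictAnti_tendsto' (one_pos (α := ℝ))
  replace hc0 := hc0.mono_left Nat.hyperfilter_le_atTop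
  choose u w h using fun n =>
    exists_isRegularizedParabolicSol (i := i) (D := D) hT.le hν hnorm (hc n).1 F
  obtain ⟨u₀, hu₀, hu⟩ := exists_weakTendsto (hyperfilter ℕ) fun n =>
    (h n).norm_le hT.le hν hnorm (hc n)
  set A : TimeL2 T V →L[ℝ] TimeL2 T V := ν • (lift T D.adjoint ∘L lift T D)
  have hbalance : ∀ n, lift T i.adjoint (w n) = F - A (u n) := fun n =>
    eq_sub_of_add_eq (h n).balance
  have hFA : WeakTendsto (fun n => F - A (u n)) (hyperfilter ℕ) (F - A u₀) :=
    (hu.map A).const_sub F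
  refine ⟨u₀, ?_, hu₀, fun t ht => ?_, fun t ht => ?_⟩
  · have hposition : (fun n => lift T i.adjoint (lift T i (u n)))
        = fun n => volterra T V (F - A (u n)) + c n • (F - A (u n)) := by
      funext n
      rw [(h n).position, map_add, map_smul, ← volterra_lift, hbalance]
    have hlim := (hFA.map (volterra T V)).add (hFA.smul_zero hc0)
    rw [← hposition, add_zero] at hlim
    exact ((hu.map (lift T i)).map (lift T i.adjoint)).unique hlim
  · refine ge_of_tendsto (hu (cutoff T V t F)) (Eventually.of_forall fun n => ?_)
    rw [← (h n).energy ht]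
    have := mul_nonneg (hc n).1.le (inner_cutoff_self_nonneg t (w n))
    have := mul_nonneg hν.le (inner_cutoff_self_nonneg t (lift T D (u n)))
    positivity
  · obtain ⟨v, hv, hvt⟩ := exists_weakTendsto (hyperfilter ℕ)
      fun n => (h n).norm_primitive_le hT.le hν hnorm (hc n) ht
    refine ⟨v, hv, (hvt.map i.adjoint).unique ?_⟩
    have hlim := hFA.map (primitive T V t)
    simp only [← hbalance, primitive_lift] at hlim
    exact hlim

theorem exists_parabolicOperator (hT : 0 < T) (hν : 0 < ν) (hnorm : IsGraphNorm i D) :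
    ∃ S : TimeL2 T V →L[ℝ] TimeL2 T V, (∀ F, IsParabolicSol i D ν F (S F)) ∧
      IsCausallyMonotone S ∧
      ∀ F, ∃ C : ℝ, ∀ t ∈ Icc 0 T, ∃ v : H, ‖v‖ ≤ C ∧
        i.adjoint v = primitive T V t (F - ν • lift T D.adjoint (lift T D (S F))) := by
  choose S hsol hnormS hmono htrace using exists_isParabolicSol (i := i) (D := D) hT hν hnorm
  refine ⟨LinearMap.mkContinuous
    { toFun := S
      map_add' := fun F F' => (hsol _).unique hT hν hnorm ((hsol F).add (hsol F'))
      map_smul' := fun a F => (hsol _).unique hT hν hnorm ((hsol F).smul a) } _ hnormS, hsol,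
    fun t ht F => hmono F t ht, fun F => ⟨_, htrace F⟩⟩

end Parabolic

/-! ## Moving convex sets -/

section Relaxation

theorem add_integral_le_of_relaxation {ψ : ℝ → ℝ} {a b c t : ℝ} (hc : 0 < c) (ht : 0 ≤ t)
    (hψ : IntervalIntegrable ψ volume 0 t) (ha : a ≤ b)
    (h : ∀ᵐ s, s ∈ Ioo 0 t → a + (∫ r in (0 : ℝ)..s, ψ r) + c * ψ s ≤ b) :
    a + ∫ r in (0 : ℝ)..t, ψ r ≤ b := by
  set φ : ℝ → ℝ := fun s => a + ∫ r in (0 : ℝ)..s, ψ r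
  have hφ : ContinuousOn φ (Icc 0 t) := by
    have hprim := intervalIntegral.continuousOn_primitive_interval
      ((intervalIntegrable_iff' (by simp)).1 hψ)
    rw [uIcc_of_le ht] at hprim
    exact continuousOn_const.add hprim
  -- Let `m` be the last time at which `φ ≤ b`. Afterwards `ψ ≤ 0`, so `φ` does not increase.
  obtain ⟨m, ⟨hm, hmb⟩, hlast⟩ := (isCompact_Icc.of_isClosed_subset
    (hφ.preimage_isClosed_of_isClosed isClosed_Icc (isClosed_Iic (a := b))) inter_subset_left
    ).exists_isGreatest ⟨0, left_mem_Icc.2 ht, by simpa [φ] using ha⟩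
  have hψm : IntervalIntegrable ψ volume 0 m :=
    hψ.mono_set (uIcc_subset_uIcc_left (by rwa [uIcc_of_le ht]))
  have hmt : IntervalIntegrable ψ volume m t := hψm.symm.trans hψ
  have hdecr : ∫ r in m..t, ψ r ≤ ∫ _ in m..t, (0 : ℝ) := by
    refine intervalIntegral.integral_mono_ae_restrict hm.2 hmt intervalIntegrable_const ?_
    rw [Measure.restrict_congr_set Ioo_ae_eq_Icc.symm]
    filter_upwards [ae_restrict_of_ae h, ae_restrict_mem measurableSet_Ioo] with s hs hsm
    have hφs : b < φ s := not_le.1 fun hle =>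
      hsm.1.not_ge (hlast ⟨⟨hm.1.trans hsm.1.le, hsm.2.le⟩, hle⟩)
    refine nonpos_of_mul_nonpos_right (b := ψ s) (a := c) ?_ hc
    linarith [hs ⟨hm.1.trans_lt hsm.1, hsm.2⟩]
  rw [intervalIntegral.integral_zero] at hdecr
  have hsplit := intervalIntegral.integral_add_adjacent_intervals hψm hmt
  have hφm : φ m ≤ b := hmb
  linarith

variable {E : Type*} [NormedAddCommGroup E] [NormedSpace ℝ E] [CompleteSpace E] {C : Set E}

theorem add_integral_mem_of_relaxation (hcl : IsClosed C) (hcv : Convex ℝ C) {w : ℝ → E} {a : E}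
    {c t : ℝ} (hc : 0 < c) (ht : 0 ≤ t) (hw : IntervalIntegrable w volume 0 t) (ha : a ∈ C)
    (h : ∀ᵐ s, s ∈ Ioo 0 t → a + (∫ r in (0 : ℝ)..s, w r) + c • w s ∈ C) :
    a + ∫ r in (0 : ℝ)..t, w r ∈ C := by
  by_contra hnot
  obtain ⟨f, b, hf, hb⟩ := geometric_hahn_banach_closed_point hcv hcl hnot
  have hint : ∀ s ∈ Icc 0 t, ∫ r in (0 : ℝ)..s, f (w r) = f (∫ r in (0 : ℝ)..s, w r) :=
    fun s hs => f.intervalIntegral_comp_comm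
      (hw.mono_set (uIcc_subset_uIcc_left (by rwa [uIcc_of_le ht])))
  refine hb.not_ge ?_
  rw [map_add, ← hint t (right_mem_Icc.2 ht)]
  refine add_integral_le_of_relaxation hc ht ⟨f.integrable_comp hw.1, f.integrable_comp hw.2⟩
    (hf a ha).le ?_
  filter_upwards [h] with s hs hmem
  simpa [hint s (Ioo_subset_Icc_self hmem)] using (hf _ (hs hmem)).le

end Relaxation

theorem forall_mem_of_ae_mem {E : Type*} [NormedAddCommGroup E] {T : ℝ} (hT : 0 < T)
    {S : Set E} (hS : IsClosed S) (hne : S.Nonempty) {u : ℝ → E}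
    (hu : ContinuousOn u (Icc 0 T)) (h : ∀ᵐ t ∂(timeMeasure T), u t ∈ S) :
    ∀ t ∈ Icc 0 T, u t ∈ S := by
  have hdist : EqOn (fun t => Metric.infDist (u t) S) (fun _ => (0 : ℝ)) (Icc 0 T) := by
    refine eqOn_of_ae_eq hT ((Metric.continuous_infDist_pt S).comp_continuousOn hu)
      continuousOn_const ?_
    filter_upwards [h] with t ht using Metric.infDist_zero_of_mem ht
  exact fun t ht => (hS.mem_iff_infDist_zero hne).2 (hdist ht)

section Selections

variable {X : Type*} [NormedAddCommGroup X] {T : ℝ} {M : ℝ → Set X}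

/-- The `L²` functions with values in the moving set `M`. -/
def selections (T : ℝ) (M : ℝ → Set X) : Set (TimeL2 T X) :=
  {x | ∀ᵐ t ∂(timeMeasure T), x t ∈ M t}

theorem isClosed_selections (hM : ∀ t ∈ Icc 0 T, IsClosed (M t)) :
    IsClosed (selections T M) := by
  refine IsSeqClosed.isClosed fun u x hu hux => ?_
  obtain ⟨φ, -, hφ⟩ := (tendstoInMeasure_of_tendsto_Lp hux).exists_seq_tendsto_ae
  filter_upwards [hφ, ae_all_iff.2 fun n => hu (φ n), ae_timeMeasure_mem T] with t hlim hmem ht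
  exact (hM t (Ioo_subset_Icc_self ht)).mem_of_tendsto hlim (Eventually.of_forall hmem)

theorem convex_selections [NormedSpace ℝ X] (hM : ∀ t ∈ Icc 0 T, Convex ℝ (M t)) :
    Convex ℝ (selections T M) := fun x hx y hy a b ha hb hab => by
  filter_upwards [hx, hy, Lp.coeFn_add (a • x) (b • y), Lp.coeFn_smul a x, Lp.coeFn_smul b y,
    ae_timeMeasure_mem T] with t hxt hyt hadd hax hby ht
  rw [hadd, Pi.add_apply, hax, hby]
  exact hM t (Ioo_subset_Icc_self ht) hxt hyt ha hb hab

theorem zero_mem_selections (hM : ∀ t ∈ Icc 0 T, 0 ∈ M t) : (0 : TimeL2 T X) ∈ selections T M := by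
  filter_upwards [Lp.coeFn_zero X 2 (timeMeasure T), ae_timeMeasure_mem T] with t hzero ht
  rw [hzero]
  exact hM t (Ioo_subset_Icc_self ht)

theorem add_cutoff_sub_mem_selections [NormedSpace ℝ X] {x y : TimeL2 T X}
    (hx : x ∈ selections T M) (hy : y ∈ selections T M) (t : ℝ) :
    x + cutoff T X t (y - x) ∈ selections T M := by
  filter_upwards [hx, hy, Lp.coeFn_add x (cutoff T X t (y - x)), coeFn_cutoff t (y - x),
    Lp.coeFn_sub y x] with s hxs hys hadd hcutoff hsub
  rw [hadd, Pi.add_apply, hcutoff]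
  by_cases hs : s ∈ Iic t
  · rwa [indicator_of_mem hs, hsub, Pi.sub_apply, add_sub_cancel]
  · rwa [indicator_of_notMem hs, add_zero]

end Selections

section SweepingFamily

variable {X : Type*} [NormedAddCommGroup X] [NormedSpace ℝ X] {T κ : ℝ} {ρ : TimeL2 T ℝ}
  {K : ℝ → ℝ → Set X}

theorem norm_sub_smul_le (hκ : 0 < κ) (e : ℝ) (y : X) :
    ‖y - (κ / (κ + |e|)) • y‖ ≤ |e| / κ * ‖y‖ := by
  have hden : 0 < κ + |e| := by positivity
  have hcoeff : (1 : ℝ) - κ / (κ + |e|) = |e| / (κ + |e|) := by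
    rw [one_sub_div hden.ne', add_sub_cancel_left]
  rw [← one_smul ℝ y, smul_smul, mul_one, ← sub_smul, hcoeff, norm_smul,
    Real.norm_of_nonneg (by positivity), one_smul]
  gcongr
  linarith [abs_nonneg e]

/-- A family of closed convex sets `K t c`, where `K t 0` is the moving set of a sweeping process
and `K t c` a relaxation of it. The motion is controlled by the absolutely continuous function
`t ↦ ∫₀ᵗ ρ`: `K s 0` is contained in the relaxation of `K t 0` of size `|∫ₛᵗ ρ|`, and a point of
the relaxation of size `c` is moved into `K t 0` by multiplication with `κ / (κ + c)`. -/
structure IsSweepingFamily (T κ : ℝ) (ρ : TimeL2 T ℝ) (K : ℝ → ℝ → Set X) : Prop where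
  pos : 0 < κ
  monotone_primitive : MonotoneOn (fun t => primitive T ℝ t ρ) (Icc 0 T)
  isClosed : ∀ t ∈ Icc 0 T, IsClosed {p : X × ℝ | p.1 ∈ K t p.2}
  convex : ∀ t ∈ Icc 0 T, Convex ℝ {p : X × ℝ | p.1 ∈ K t p.2}
  zero_mem : ∀ t ∈ Icc 0 T, 0 ∈ K t 0
  mono : ∀ t ∈ Icc 0 T, Monotone (K t)
  shift : ∀ s ∈ Icc 0 T, ∀ t ∈ Icc 0 T, K s 0 ⊆ K t |primitive T ℝ t ρ - primitive T ℝ s ρ|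
  scale : ∀ t ∈ Icc 0 T, ∀ c, 0 ≤ c → ∀ τ ∈ K t c, (κ / (κ + c)) • τ ∈ K t 0

namespace IsSweepingFamily

variable (h : IsSweepingFamily T κ ρ K)
include h

theorem isClosed_zero {t : ℝ} (ht : t ∈ Icc 0 T) : IsClosed (K t 0) :=
  (h.isClosed t ht).preimage (Continuous.prodMk_left (0 : ℝ))

theorem convex_zero {t : ℝ} (ht : t ∈ Icc 0 T) : Convex ℝ (K t 0) := by
  intro x hx y hy a b ha hb hab
  simpa using h.convex t ht (x := (x, 0)) hx (y := (y, 0)) hy ha hb hab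

theorem shift_le {s t : ℝ} (hs : s ∈ Icc 0 T) (ht : t ∈ Icc 0 T) (hst : s ≤ t) :
    K s 0 ⊆ K t (primitive T ℝ t ρ - primitive T ℝ s ρ) := by
  simpa only [abs_of_nonneg (sub_nonneg.2 (h.monotone_primitive hs ht hst))]
    using h.shift s hs t ht

theorem scale_mem {t e : ℝ} (ht : t ∈ Icc 0 T) {τ : X} (hτ : τ ∈ K t e) :
    (κ / (κ + |e|)) • τ ∈ K t 0 :=
  h.scale t ht _ (abs_nonneg e) τ (h.mono t ht (le_abs_self e) hτ)

end IsSweepingFamily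

end SweepingFamily

section NearSelection

variable {X : Type*} [NormedAddCommGroup X] [InnerProductSpace ℝ X] {T κ : ℝ}
  {ρ p : TimeL2 T ℝ} {K : ℝ → ℝ → Set X} {σ₀ : X} {c : ℝ} {w : TimeL2 T X}

theorem ae_primitive_sub_primitive_eq (hp : volterra T ℝ p + c • p = volterra T ℝ ρ) :
    ∀ᵐ t ∂(timeMeasure T), primitive T ℝ t ρ - primitive T ℝ t p = c * p t := by
  filter_upwards [coeFn_volterra p, coeFn_volterra ρ, Lp.coeFn_add (volterra T ℝ p) (c • p),
    Lp.coeFn_smul c p] with t hVp hVρ hadd hsmul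
  rw [hp, hVρ, Pi.add_apply, hVp, hsmul, Pi.smul_apply, smul_eq_mul] at hadd
  rw [hadd, add_sub_cancel_left]

theorem ae_add_primitive_add_smul_mem {M : ℝ → Set X}
    (hx : trajectory σ₀ w + c • w ∈ selections T M) :
    ∀ᵐ t ∂(timeMeasure T), σ₀ + primitive T X t w + c • w t ∈ M t := by
  filter_upwards [hx, Lp.coeFn_add (trajectory σ₀ w) (c • w), coeFn_trajectory σ₀ w,
    Lp.coeFn_smul c w] with t hxt hadd htraj hsmul
  rwa [hadd, Pi.add_apply, htraj, hsmul] at hxt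

variable (h : IsSweepingFamily T κ ρ K)
include h

-- The pair `(σ₀ + ∫₀ w, -∫₀ p)` relaxes towards `{(τ, e) | τ ∈ K t e}`.
theorem IsSweepingFamily.add_primitive_mem [CompleteSpace X] (hc : 0 < c) (hσ₀ : σ₀ ∈ K 0 0)
    (hx : trajectory σ₀ w + c • w ∈ selections T (K · 0))
    (hp : volterra T ℝ p + c • p = volterra T ℝ ρ) {t : ℝ} (ht : t ∈ Icc 0 T) :
    σ₀ + primitive T X t w ∈ K t (primitive T ℝ t ρ - primitive T ℝ t p) := by
  have hIcc : ∀ s ∈ Icc 0 t, s ∈ Icc 0 T := fun s hs => ⟨hs.1, hs.2.trans ht.2⟩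
  have hT : 0 ≤ T := ht.1.trans ht.2
  have hpair : ∀ s ∈ Icc 0 t,
      ∫ r in (0 : ℝ)..s, (w r, -p r) = (primitive T X s w, -primitive T ℝ s p) := fun s hs => by
    have hw := intervalIntegrable_of_integrable w.integrable (hIcc s hs)
    have hps := (intervalIntegrable_of_integrable p.integrable (hIcc s hs)).neg
    rw [primitive_eq w (hIcc s hs), primitive_eq p (hIcc s hs), ← intervalIntegral.integral_neg]
    simp only [intervalIntegral.integral_of_le hs.1]
    exact integral_pair hw.1 hps.1
  have hmem := add_integral_mem_of_relaxation (h.isClosed t ht) (h.convex t ht) hc ht.1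
    (w := fun r => (w r, -p r)) (a := (σ₀, primitive T ℝ t ρ)) ?_ ?_ ?_
  · rwa [hpair t (right_mem_Icc.2 ht.1), Prod.mk_add_mk, ← sub_eq_add_neg] at hmem
  · have hw := intervalIntegrable_of_integrable w.integrable ht
    have hpt := (intervalIntegrable_of_integrable p.integrable ht).neg
    exact ⟨hw.1.prodMk hpt.1, hw.2.prodMk hpt.2⟩
  · simpa [primitive_zero hT] using h.shift_le (left_mem_Icc.2 hT) ht ht.1 hσ₀
  · filter_upwards [(ae_restrict_iff' measurableSet_Ioo).1 (ae_add_primitive_add_smul_mem hx),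
      (ae_restrict_iff' measurableSet_Ioo).1 (ae_primitive_sub_primitive_eq hp)]
      with s hxs hps hs
    have hsT : s ∈ Ioo 0 T := ⟨hs.1, hs.2.trans_le ht.2⟩
    have hshift := h.shift_le (Ioo_subset_Icc_self hsT) ht hs.2.le (hxs hsT)
    have hsize : primitive T ℝ t ρ - primitive T ℝ s ρ
        = primitive T ℝ t ρ + -primitive T ℝ s p + c * -p s := by linarith [hps hsT]
    rw [hsize] at hshift
    rw [hpair s (Ioo_subset_Icc_self hs)]
    exact hshift

theorem IsSweepingFamily.exists_scaled_selection {e : ℝ → ℝ} (he : ContinuousOn e (Icc 0 T))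
    {u : ℝ → X} (hu : ContinuousOn u (Icc 0 T)) (hmem : ∀ t ∈ Icc 0 T, u t ∈ K t (e t)) :
    ∃ y ∈ selections T (K · 0), ∀ᵐ t ∂(timeMeasure T), ‖u t - y t‖ ≤ |e t| / κ * ‖u t‖ := by
  have hκ := h.pos
  let y : ℝ → X := fun t => (κ / (κ + |e t|)) • u t
  have hy : MemLp y 2 (timeMeasure T) := memLp_of_continuousOn <|
    (continuousOn_const.div (continuousOn_const.add he.abs) fun t _ =>
      (add_pos_of_pos_of_nonneg hκ (abs_nonneg (e t))).ne').smul hu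
  refine ⟨hy.toLp y, ?_, ?_⟩
  · filter_upwards [hy.coeFn_toLp, ae_timeMeasure_mem T] with t hyt ht
    rw [hyt]
    exact h.scale_mem (Ioo_subset_Icc_self ht) (hmem t (Ioo_subset_Icc_self ht))
  · filter_upwards [hy.coeFn_toLp] with t hyt
    rw [hyt]
    exact norm_sub_smul_le hκ _ _

theorem IsSweepingFamily.exists_selection_near [CompleteSpace X] (hT : 0 ≤ T) (hc : 0 < c)
    (hσ₀ : σ₀ ∈ K 0 0) (hx : trajectory σ₀ w + c • w ∈ selections T (K · 0)) {M : ℝ}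
    (hM0 : 0 ≤ M) (hM : ∀ t ∈ Icc 0 T, ‖σ₀ + primitive T X t w‖ ≤ M) :
    ∃ y ∈ selections T (K · 0), ‖trajectory σ₀ w - y‖ ≤ c * (M / κ * ‖ρ‖) := by
  have hκ := h.pos
  obtain ⟨R, hR, -⟩ := exists_resolvent (inner_volterra_nonneg (X := ℝ) hT) hc
  obtain ⟨p, hp⟩ : ∃ p, volterra T ℝ p + c • p = volterra T ℝ ρ := ⟨_, hR _⟩
  obtain ⟨y, hyK, hy⟩ := h.exists_scaled_selection
    ((continuousOn_primitive ρ).sub (continuousOn_primitive p))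
    (continuousOn_const_add_primitive σ₀ w) fun t => h.add_primitive_mem hc hσ₀ hx hp
  have hdist : ∀ᵐ t ∂(timeMeasure T), ‖(trajectory σ₀ w - y) t‖ ≤ c * (M / κ) * ‖p t‖ := by
    filter_upwards [hy, coeFn_trajectory σ₀ w, ae_primitive_sub_primitive_eq hp,
      Lp.coeFn_sub (trajectory σ₀ w) y, ae_timeMeasure_mem T] with t hyt htraj het hsub ht
    rw [Pi.sub_apply, het, abs_mul, abs_of_pos hc] at hyt
    rw [hsub, Pi.sub_apply, htraj, Real.norm_eq_abs]
    calc ‖σ₀ + primitive T X t w - y t‖ ≤ c * |p t| / κ * ‖σ₀ + primitive T X t w‖ := hyt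
      _ ≤ c * |p t| / κ * M :=
          mul_le_mul_of_nonneg_left (hM t (Ioo_subset_Icc_self ht)) (by positivity)
      _ = c * (M / κ) * |p t| := by ring
  have hpρ : ‖p‖ ≤ ‖ρ‖ :=
    norm_le_of_apply_add_smul_eq (V := volterra T ℝ) (inner_volterra_nonneg hT) hc hp
  refine ⟨y, hyK, ?_⟩
  calc ‖trajectory σ₀ w - y‖ ≤ c * (M / κ) * ‖p‖ := Lp.norm_le_mul_norm_of_ae_le_mul hdist
    _ ≤ c * (M / κ) * ‖ρ‖ := mul_le_mul_of_nonneg_left hpρ (by positivity)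
    _ = c * (M / κ * ‖ρ‖) := mul_assoc _ _ _

end NearSelection

/-! ## The perturbed sweeping process -/

section SweepingSolution

variable {X : Type*} [NormedAddCommGroup X] [InnerProductSpace ℝ X] [CompleteSpace X] {T : ℝ}

/-- `x` solves the sweeping process `w + ∂I_M(x) + A x ∋ F`, integrated in time, where `w` is the
Yosida approximation of the time derivative of `x` with parameter `c` and initial value `σ₀`; for
`c = 0` it is the derivative itself. -/
structure IsSweepingSol (M : ℝ → Set X) (A : TimeL2 T X →L[ℝ] TimeL2 T X) (c : ℝ)
    (F : TimeL2 T X) (σ₀ : X) (x w : TimeL2 T X) : Prop where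
  mem : x ∈ selections T M
  position : x = trajectory σ₀ w + c • w
  variational : ∀ τ ∈ selections T M, inner ℝ (w + A x - F) (x - τ) ≤ 0

variable {M : ℝ → Set X} {A : TimeL2 T X →L[ℝ] TimeL2 T X} {c : ℝ} {F x w : TimeL2 T X} {σ₀ : X}

theorem exists_isSweepingSol_of_pos (hT : 0 ≤ T) (hcl : ∀ t ∈ Icc 0 T, IsClosed (M t))
    (hcv : ∀ t ∈ Icc 0 T, Convex ℝ (M t)) (hne : (selections T M).Nonempty)
    (hA : ∀ x, 0 ≤ inner ℝ (A x) x) (hc : 0 < c) (F : TimeL2 T X) (σ₀ : X) :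
    ∃ x w, IsSweepingSol M A c F σ₀ x w := by
  obtain ⟨R, hR, k, hk, hRk⟩ := exists_resolvent (inner_volterra_nonneg (X := X) hT) hc
  let a : TimeL2 T X := Lp.const 2 (timeMeasure T) σ₀
  obtain ⟨x, hx, hvar⟩ := exists_variationalInequality (R + A) hk
    (fun z => by
      rw [_root_.add_apply, inner_add_left]
      linarith [hRk z, hA z])
    hne (isClosed_selections hcl) (convex_selections hcv) (F + R a)
  refine ⟨x, R (x - a), hx, ?_, fun τ hτ => ?_⟩
  · rw [trajectory, add_assoc, hR, add_sub_cancel]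
  · have hresidual : R (x - a) + A x - F = (R + A) x - (F + R a) := by
      rw [_root_.add_apply, map_sub]
      abel
    exact hresidual ▸ hvar τ hτ

namespace IsSweepingSol

variable (h : IsSweepingSol M A c F σ₀ x w)
include h

theorem energy_le (hA : IsCausallyMonotone A) (hM : ∀ t ∈ Icc 0 T, 0 ∈ M t) {t : ℝ}
    (ht : t ∈ Icc 0 T) :
    ‖σ₀ + primitive T X t w‖ ^ 2 + 2 * (c * inner ℝ (cutoff T X t w) w)
      ≤ ‖σ₀‖ ^ 2 + 2 * (‖F‖ * ‖x‖) := by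
  have htest := h.variational _ (add_cutoff_sub_mem_selections h.mem (zero_mem_selections hM) t)
  have hdiff : x - (x + cutoff T X t (0 - x)) = cutoff T X t x := by
    rw [zero_sub, map_neg, sub_add_cancel_left, neg_neg]
  rw [hdiff, inner_sub_left, inner_add_left, inner_cutoff_right, real_inner_comm _ (A x)] at htest
  have hkinetic : inner ℝ (cutoff T X t w) x
      = 1 / 2 * (‖σ₀ + primitive T X t w‖ ^ 2 - ‖σ₀‖ ^ 2)
        + c * inner ℝ (cutoff T X t w) w := by
    nth_rw 1 [h.position]
    rw [inner_add_right, inner_cutoff_trajectory σ₀ w ht, inner_smul_right]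
  have hforce : inner ℝ F (cutoff T X t x) ≤ ‖F‖ * ‖x‖ := (real_inner_le_norm _ _).trans
    (mul_le_mul_of_nonneg_left (norm_cutoff_le t x) (norm_nonneg F))
  linarith [hA t ht x]

end IsSweepingSol

theorem le_of_sq_le_add_mul {x a b : ℝ} (ha : 0 ≤ a) (hb : 0 ≤ b) (h : x ^ 2 ≤ a + b * x) :
    x ≤ a + b + 1 := by
  by_contra! hlt
  nlinarith

theorem exists_bound_position (hT : 0 ≤ T) (hA : IsCausallyMonotone A)
    (hM : ∀ t ∈ Icc 0 T, 0 ∈ M t) (F : TimeL2 T X) (σ₀ : X) :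
    ∃ B ≥ 0, ∀ c ∈ Ioo (0 : ℝ) 1, ∀ x w, IsSweepingSol M A c F σ₀ x w →
      ‖x‖ ≤ B ∧ ∀ t ∈ Icc 0 T, ‖σ₀ + primitive T X t w‖ ≤ B := by
  let D : ℝ := (2 * T + 1) * ‖σ₀‖ ^ 2 + (2 * T + 1) * (2 * ‖F‖) + 1
  have hD : 0 ≤ D := by positivity
  refine ⟨max D √(‖σ₀‖ ^ 2 + 2 * (‖F‖ * D)), le_max_of_le_left hD, fun c hc x w h => ?_⟩
  have henergy := fun t (ht : t ∈ Icc 0 T) => h.energy_le hA hM ht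
  have hx : ‖x‖ ≤ D := by
    refine le_of_sq_le_add_mul (by positivity) (by positivity) ?_
    have hsq := norm_trajectory_add_smul_sq_le hT hc henergy
    rw [← h.position] at hsq
    linarith
  refine ⟨le_max_of_le_left hx, fun t ht => le_max_of_le_right (Real.le_sqrt_of_sq_le ?_)⟩
  have hrelax : 0 ≤ 2 * (c * inner ℝ (cutoff T X t w) w) :=
    mul_nonneg zero_le_two (mul_nonneg hc.1.le (inner_cutoff_self_nonneg t w))
  linarith [henergy t ht, mul_le_mul_of_nonneg_left hx (norm_nonneg F)]

theorem norm_le_of_inner_add_le_zero {E : Type*} [NormedAddCommGroup E] [InnerProductSpace ℝ E]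
    {w q d : E} {N k : ℝ} (hc : 0 < c) (hN : 0 ≤ N) (hk : 0 ≤ k)
    (h : inner ℝ (w + q) (c • w + d) ≤ 0) (hd : ‖d‖ ≤ c * N) (hq : ‖q‖ ≤ k) :
    ‖w‖ ≤ N * k + (N + k) + 1 := by
  refine le_of_sq_le_add_mul (by positivity) (by positivity) (le_of_mul_le_mul_left ?_ hc)
  have hwd : -(‖w‖ * (c * N)) ≤ inner ℝ w d := neg_le_of_abs_le <|
    (abs_real_inner_le_norm w d).trans (mul_le_mul_of_nonneg_left hd (norm_nonneg w))
  have hsum : ‖c • w + d‖ ≤ c * (‖w‖ + N) := by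
    calc ‖c • w + d‖ ≤ ‖c • w‖ + ‖d‖ := norm_add_le _ _
      _ ≤ c * (‖w‖ + N) := by
          rw [norm_smul, Real.norm_of_nonneg hc.le]
          linarith
  have hqd : -(k * (c * (‖w‖ + N))) ≤ inner ℝ q (c • w + d) := neg_le_of_abs_le <|
    (abs_real_inner_le_norm _ _).trans (mul_le_mul hq hsum (norm_nonneg _) hk)
  rw [inner_add_left, inner_add_right w, inner_smul_right, real_inner_self_eq_norm_sq] at h
  linarith

variable {κ : ℝ} {ρ : TimeL2 T ℝ} {K : ℝ → ℝ → Set X} (hK : IsSweepingFamily T κ ρ K)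
include hK

theorem exists_bound_velocity (hT : 0 ≤ T) (hA : IsCausallyMonotone A) (hσ₀ : σ₀ ∈ K 0 0)
    (F : TimeL2 T X) :
    ∃ C, ∀ c ∈ Ioo (0 : ℝ) 1, ∀ x w, IsSweepingSol (K · 0) A c F σ₀ x w → ‖w‖ ≤ C := by
  obtain ⟨B, hB, hbound⟩ := exists_bound_position hT hA hK.zero_mem F σ₀
  have hκ := hK.pos
  let N : ℝ := B / κ * ‖ρ‖
  let k : ℝ := ‖A‖ * B + ‖F‖
  refine ⟨N * k + (N + k) + 1, fun c hc x w h => ?_⟩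
  obtain ⟨hx, hpath⟩ := hbound c hc x w h
  obtain ⟨y, hy, hdist⟩ := hK.exists_selection_near hT hc.1 hσ₀ (h.position ▸ h.mem) hB hpath
  have hq : ‖A x - F‖ ≤ k := (norm_sub_le _ _).trans <|
    add_le_add_left (A.le_of_opNorm_le_of_le le_rfl hx) _
  refine norm_le_of_inner_add_le_zero hc.1 (by positivity) (by positivity) ?_ hdist hq
  have hxy : c • w + (trajectory σ₀ w - y) = x - y := by
    rw [← add_sub_assoc, add_comm, ← h.position]
  rw [hxy, ← add_sub_assoc]
  exact h.variational y hy

theorem IsSweepingSol.of_weakTendsto (hT : 0 ≤ T) (hA : IsCausallyMonotone A) {l : Filter ℕ}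
    [l.NeBot] {c : ℕ → ℝ} {x w : ℕ → TimeL2 T X} {w₀ : TimeL2 T X} (hc : ∀ n, 0 ≤ c n)
    (hlim : Tendsto c l (𝓝 0)) (h : ∀ n, IsSweepingSol (K · 0) A (c n) F σ₀ (x n) (w n))
    (hw : WeakTendsto w l w₀) :
    IsSweepingSol (K · 0) A 0 F σ₀ (trajectory σ₀ w₀) w₀ := by
  let a : TimeL2 T X := Lp.const 2 (timeMeasure T) σ₀
  have hx : WeakTendsto x l (trajectory σ₀ w₀) := by
    have hsum := ((hw.map (volterra T X)).const_add a).add (hw.smul_zero hlim)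
    rw [add_zero] at hsum
    exact (funext fun n => (h n).position) ▸ hsum
  refine ⟨hx.mem (isClosed_selections fun t => hK.isClosed_zero)
    (convex_selections fun t => hK.convex_zero) fun n => (h n).mem, by simp, fun τ hτ => ?_⟩
  obtain ⟨mV, hmV, hmVlim⟩ := hw.exists_minorant (A := volterra T X) fun z => by
    rw [real_inner_comm]; exact inner_volterra_nonneg hT z
  obtain ⟨mA, hmA, hmAlim⟩ := hx.exists_minorant (hA.inner_nonneg hT)
  have hle : ∀ n, mV n + inner ℝ a (w n) + mA n - inner ℝ τ (w n) - inner ℝ τ (A (x n))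
      - inner ℝ F (x n) + inner ℝ F τ ≤ 0 := fun n => by
    have hvar := (h n).variational τ hτ
    have hwx : inner ℝ (w n) (x n) = inner ℝ a (w n) + inner ℝ (volterra T X (w n)) (w n)
        + c n * ‖w n‖ ^ 2 := by
      nth_rw 1 [(h n).position]
      rw [trajectory, inner_add_right, inner_add_right, inner_smul_right,
        real_inner_self_eq_norm_sq, real_inner_comm (w n), real_inner_comm (w n)]
    simp only [inner_sub_left, inner_sub_right, inner_add_left] at hvar
    rw [real_inner_comm τ (w n), real_inner_comm τ (A (x n))] at hvar
    linarith [hmV n, hmA n, mul_nonneg (hc n) (sq_nonneg ‖w n‖)]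
  have hlimit := le_of_tendsto ((((((hmVlim.add (hw a)).add hmAlim).sub (hw τ)).sub
    (hx.map A τ)).sub (hx F)).add_const (inner ℝ F τ)) (Eventually.of_forall hle)
  have hwx : inner ℝ w₀ (trajectory σ₀ w₀) = inner ℝ a w₀ + inner ℝ (volterra T X w₀) w₀ := by
    rw [trajectory, inner_add_right, real_inner_comm w₀, real_inner_comm w₀]
  simp only [inner_sub_left, inner_sub_right, inner_add_left]
  rw [real_inner_comm τ w₀, real_inner_comm τ (A _)]
  linarith

theorem exists_isSweepingSol (hT : 0 ≤ T) (hA : IsCausallyMonotone A) (hσ₀ : σ₀ ∈ K 0 0)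
    (F : TimeL2 T X) : ∃ w, IsSweepingSol (K · 0) A 0 F σ₀ (trajectory σ₀ w) w := by
  obtain ⟨C, hC⟩ := exists_bound_velocity hK hT hA hσ₀ F
  obtain ⟨c, -, hc, hlim⟩ := exists_seq_strictAnti_tendsto' one_pos (α := ℝ)
  choose x w h using fun n => exists_isSweepingSol_of_pos hT (fun t => hK.isClosed_zero)
    (fun t => hK.convex_zero) ⟨0, zero_mem_selections hK.zero_mem⟩ (hA.inner_nonneg hT)
    (hc n).1 F σ₀
  obtain ⟨w₀, -, hw⟩ := exists_weakTendsto (hyperfilter ℕ) fun n => hC _ (hc n) _ _ (h n)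
  exact ⟨w₀, .of_weakTendsto hK hT hA (fun n => (hc n).1.le)
    (hlim.mono_left Nat.hyperfilter_le_atTop) h hw⟩

end SweepingSolution

section Localization

variable {X : Type*} [NormedAddCommGroup X] [InnerProductSpace ℝ X] {T : ℝ}

theorem inner_integral_le_of_norm_sub_le {q η : ℝ → X} {t s ε : ℝ} {a : X} [CompleteSpace X]
    (hts : t ≤ s) (hq : IntervalIntegrable q volume t s)
    (hqη : IntervalIntegrable (fun r => inner ℝ (q r) (η r)) volume t s)
    (hnear : ∀ r ∈ Ioc t s, ‖a - η r‖ ≤ ε) (hneg : ∫ r in t..s, inner ℝ (q r) (η r) ≤ 0) :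
    inner ℝ (∫ r in t..s, q r) a ≤ ε * ∫ r in t..s, ‖q r‖ := by
  have hqa : IntervalIntegrable (fun r => inner ℝ (q r) a) volume t s :=
    ⟨hq.1.inner_const _, hq.2.inner_const _⟩
  calc inner ℝ (∫ r in t..s, q r) a = ∫ r in t..s, inner ℝ (q r) a := by
        simp_rw [real_inner_comm a]
        exact ((innerSL ℝ a).intervalIntegral_comp_comm hq).symm
    _ ≤ ∫ r in t..s, (inner ℝ (q r) (η r) + ε * ‖q r‖) := by
        simp only [intervalIntegral.integral_of_le hts]
        refine setIntegral_mono_on hqa.1 (hqη.add (hq.norm.const_mul ε)).1 measurableSet_Ioc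
          fun r hr => ?_
        rw [← sub_le_iff_le_add', ← inner_sub_right, mul_comm]
        exact (real_inner_le_norm _ _).trans
          (mul_le_mul_of_nonneg_left (hnear r hr) (norm_nonneg _))
    _ = (∫ r in t..s, inner ℝ (q r) (η r)) + ε * ∫ r in t..s, ‖q r‖ := by
        rw [intervalIntegral.integral_add hqη (hq.norm.const_mul ε),
          intervalIntegral.integral_const_mul]
    _ ≤ ε * ∫ r in t..s, ‖q r‖ := by linarith

theorem ae_inner_nonpos_of_integral_nonpos [CompleteSpace X] {q : ℝ → X}
    (hq : Integrable q (timeMeasure T)) :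
    ∀ᵐ t ∂(timeMeasure T), ∀ η : ℝ → X, ContinuousOn η (Icc 0 T) →
      (∀ s ∈ Ioc t T, IntervalIntegrable (fun r => inner ℝ (q r) (η r)) volume t s) →
      (∀ s ∈ Ioc t T, ∫ r in t..s, inner ℝ (q r) (η r) ≤ 0) → inner ℝ (q t) (η t) ≤ 0 := by
  rcases le_or_gt T 0 with hT | hT
  · filter_upwards [ae_timeMeasure_mem T] with t ht
    exact absurd (ht.1.trans ht.2) hT.not_gt
  have hqI := intervalIntegrable_of_integrable hq (right_mem_Icc.2 hT.le)
  filter_upwards [ae_restrict_of_ae hqI.ae_hasDerivAt_integral,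
    ae_restrict_of_ae hqI.norm.ae_hasDerivAt_integral, ae_timeMeasure_mem T]
    with t hderiv hderivNorm ht η hη hqη hneg
  have htT : t ∈ uIcc 0 T := Icc_subset_uIcc (Ioo_subset_Icc_self ht)
  have hslope := hasDerivWithinAt_iff_tendsto_slope' self_notMem_Ioi |>.1
    (hderiv htT t htT).hasDerivWithinAt
  have hslopeNorm := hasDerivWithinAt_iff_tendsto_slope' self_notMem_Ioi |>.1
    (hderivNorm htT t htT).hasDerivWithinAt
  have hright : 𝓝[>] t ≤ 𝓝[Icc 0 T] t := by
    rw [← nhdsWithin_Ioc_eq_nhdsGT ht.2]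
    exact nhdsWithin_mono t (Ioc_subset_Icc_self.trans (Icc_subset_Icc_left ht.1.le))
  have hsmall : ∀ ε > 0, inner ℝ (q t) (η t) ≤ ε * ‖q t‖ := fun ε hε => by
    refine le_of_tendsto_of_tendsto (hslope.inner tendsto_const_nhds) (hslopeNorm.const_mul ε) ?_
    have hηt : ∀ᶠ r in 𝓝[>] t, ‖η t - η r‖ ≤ ε := by
      have hcont := (hη t (Ioo_subset_Icc_self ht)).mono_left hright
      filter_upwards [Metric.tendsto_nhds.1 hcont ε hε] with r hr
      rw [norm_sub_rev, ← dist_eq_norm]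
      exact hr.le
    obtain ⟨b, hb, hnear⟩ := mem_nhdsGT_iff_exists_Ioc_subset.1 hηt
    filter_upwards [Ioc_mem_nhdsGT ht.2, Ioc_mem_nhdsGT hb] with s hs hsb
    have hmono := inner_integral_le_of_norm_sub_le hs.1.le
      (hqI.mono_set (uIcc_subset_uIcc htT (Icc_subset_uIcc ⟨ht.1.le.trans hs.1.le, hs.2⟩)))
      (hqη s hs) (fun r hr => hnear ⟨hr.1, hr.2.trans hsb.2⟩) (hneg s hs)
    have hpos : 0 ≤ (s - t)⁻¹ := inv_nonneg.2 (sub_nonneg.2 hs.1.le)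
    simp only [slope_def_module, intervalIntegral.integral_same, sub_zero, real_inner_smul_left,
      smul_eq_mul]
    rw [mul_left_comm]
    exact mul_le_mul_of_nonneg_left hmono hpos
  have hlim : Tendsto (fun ε : ℝ => ε * ‖q t‖) (𝓝[>] 0) (𝓝 (0 * ‖q t‖)) :=
    (tendsto_id.mono_left nhdsWithin_le_nhds).mul_const _
  rw [zero_mul] at hlim
  exact ge_of_tendsto hlim (eventually_mem_nhdsWithin.mono hsmall)

variable {M : ℝ → Set X}

theorem inner_cutoff_sub_cutoff_nonpos {x y q : TimeL2 T X} {t s : ℝ} (hts : t ≤ s)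
    (hx : x ∈ selections T M) (hy : y ∈ selections T M)
    (hvar : ∀ τ ∈ selections T M, inner ℝ q (x - τ) ≤ 0) :
    inner ℝ (cutoff T X s q) (x - y) - inner ℝ (cutoff T X t q) (x - y) ≤ 0 := by
  let z : TimeL2 T X := x + (cutoff T X s (y - x) - cutoff T X t (y - x))
  have hz : z ∈ selections T M := by
    filter_upwards [hx, hy, Lp.coeFn_add x (cutoff T X s (y - x) - cutoff T X t (y - x)),
      Lp.coeFn_sub (cutoff T X s (y - x)) (cutoff T X t (y - x)), coeFn_cutoff s (y - x),
      coeFn_cutoff t (y - x), Lp.coeFn_sub y x] with r hxr hyr hadd hsub hs ht hyx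
    rw [hadd, Pi.add_apply, hsub, Pi.sub_apply, hs, ht]
    by_cases hrt : r ∈ Iic t
    · rwa [indicator_of_mem hrt, indicator_of_mem (Iic_subset_Iic.2 hts hrt), sub_self, add_zero]
    · rw [indicator_of_notMem hrt, sub_zero]
      by_cases hrs : r ∈ Iic s
      · rwa [indicator_of_mem hrs, hyx, Pi.sub_apply, add_sub_cancel]
      · rwa [indicator_of_notMem hrs, add_zero]
  have hdiff : x - z = cutoff T X s (x - y) - cutoff T X t (x - y) := by
    rw [← neg_sub y x, map_neg, map_neg]
    simp only [z]
    abel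
  have hneg := hvar z hz
  rwa [hdiff, inner_sub_right, inner_cutoff_right, inner_cutoff_right] at hneg

theorem integral_inner_sub_nonpos {x q : TimeL2 T X} {σ ξ : ℝ → X}
    (hσ : x =ᵐ[timeMeasure T] σ) (hx : x ∈ selections T M)
    (hvar : ∀ τ ∈ selections T M, inner ℝ q (x - τ) ≤ 0)
    (hξ : ContinuousOn ξ (Icc 0 T)) (hξM : ∀ t ∈ Icc 0 T, ξ t ∈ M t)
    {t s : ℝ} (ht : t ∈ Icc 0 T) (hs : s ∈ Icc 0 T) (hts : t ≤ s) :
    IntervalIntegrable (fun r => inner ℝ (q r) (σ r - ξ r)) volume t s ∧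
      ∫ r in t..s, inner ℝ (q r) (σ r - ξ r) ≤ 0 := by
  have hξL := memLp_of_continuousOn hξ
  let y : TimeL2 T X := hξL.toLp ξ
  have hy : y ∈ selections T M := by
    filter_upwards [hξL.coeFn_toLp, ae_timeMeasure_mem T] with r hr hmem
    rw [hr]
    exact hξM r (Ioo_subset_Icc_self hmem)
  have hae : (fun r => inner ℝ (q r) ((x - y) r))
      =ᵐ[timeMeasure T] fun r => inner ℝ (q r) (σ r - ξ r) := by
    filter_upwards [hσ, Lp.coeFn_sub x y, hξL.coeFn_toLp] with r hxr hsub hyr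
    rw [hsub, Pi.sub_apply, hxr, hyr]
  have hint := fun r (hr : r ∈ Icc 0 T) =>
    intervalIntegrable_of_integrable ((L2.integrable_inner (𝕜 := ℝ) q (x - y)).congr hae) hr
  refine ⟨(hint t ht).symm.trans (hint s hs), ?_⟩
  have hcutoff : ∀ r ∈ Icc 0 T, inner ℝ (cutoff T X r q) (x - y)
      = ∫ p in (0 : ℝ)..r, inner ℝ (q p) (σ p - ξ p) := fun r hr => by
    rw [inner_cutoff, ← setIntegral_Iic_timeMeasure _ hr]
    exact integral_congr_ae (ae_restrict_of_ae hae)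
  rw [← intervalIntegral.integral_interval_sub_left (hint s hs) (hint t ht), ← hcutoff s hs,
    ← hcutoff t ht]
  exact inner_cutoff_sub_cutoff_nonpos hts hx hy hvar

variable [CompleteSpace X] {κ : ℝ} {ρ : TimeL2 T ℝ} {K : ℝ → ℝ → Set X}

theorem IsSweepingFamily.ae_inner_sub_nonpos (hK : IsSweepingFamily T κ ρ K) {σ : ℝ → X}
    (hσ : ContinuousOn σ (Icc 0 T)) {x q : TimeL2 T X} (hxσ : x =ᵐ[timeMeasure T] σ)
    (hx : x ∈ selections T (K · 0))
    (hvar : ∀ τ ∈ selections T (K · 0), inner ℝ q (x - τ) ≤ 0) :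
    ∀ᵐ t ∂(timeMeasure T), ∀ τ ∈ K t 0, inner ℝ (q t) (σ t - τ) ≤ 0 := by
  have hκ := hK.pos
  filter_upwards [ae_inner_nonpos_of_integral_nonpos q.integrable, ae_timeMeasure_mem T]
    with t hlocal ht τ hτ
  have htT := Ioo_subset_Icc_self ht
  let e : ℝ → ℝ := fun s => |primitive T ℝ s ρ - primitive T ℝ t ρ|
  let ξ : ℝ → X := fun s => (κ / (κ + e s)) • τ
  have hξt : ξ t = τ := by simp [ξ, e, hκ.ne']
  have hden : ∀ s, κ + e s ≠ 0 := fun s => (add_pos_of_pos_of_nonneg hκ (abs_nonneg _)).ne'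
  have hξ : ContinuousOn ξ (Icc 0 T) :=
    (continuousOn_const.div (continuousOn_const.add
      ((continuousOn_primitive ρ).sub continuousOn_const).abs) fun s _ => hden s).smul
      continuousOn_const
  have hξK : ∀ s ∈ Icc 0 T, ξ s ∈ K s 0 := fun s hs =>
    hK.scale s hs _ (abs_nonneg _) _ (hK.shift t htT s hs hτ)
  have hneg := fun s (hs : s ∈ Ioc t T) => integral_inner_sub_nonpos hxσ hx hvar hξ hξK htT
    ⟨ht.1.le.trans hs.1.le, hs.2⟩ hs.1.le
  simpa only [hξt] using hlocal (fun s => σ s - ξ s) (hσ.sub hξ) (fun s hs => (hneg s hs).1)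
    fun s hs => (hneg s hs).2

end Localization

/-! ## The velocity space -/

section VelocitySpace

variable {Ω ΓD : Set E3}

theorem continuous_setIntegral_coord_mul {ι : Type*} [Fintype ι] (i : ι) {ψ : E3 → ℝ}
    (hψ : MemLp ψ 2 (volume.restrict Ω)) :
    Continuous fun z : Lp (EuclideanSpace ℝ ι) 2 (volume.restrict Ω) =>
      ∫ x in Ω, z x i * ψ x := by
  have h : ∀ z : Lp (EuclideanSpace ℝ ι) 2 (volume.restrict Ω),
      ∫ x in Ω, z x i * ψ x = inner ℝ (hψ.toLp ψ)
        ((EuclideanSpace.proj (𝕜 := ℝ) i).compLpL 2 (volume.restrict Ω) z) := fun z => by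
    rw [L2.inner_def]
    refine integral_congr_ae ?_
    filter_upwards [hψ.coeFn_toLp,
      (EuclideanSpace.proj (𝕜 := ℝ) i : EuclideanSpace ℝ ι →L[ℝ] ℝ).coeFn_compLpL z] with x h1 h2
    rw [h1, h2]
    simp
  simp_rw [h]
  exact continuous_const.inner (ContinuousLinearMap.continuous _)

theorem isClosed_hasWeakGrad :
    IsClosed {p : WithLp 2 (HVec Ω × HGrad Ω) | HasWeakGrad Ω p.fst p.snd} := by
  simp only [HasWeakGrad, ofPred_forall]
  refine isClosed_iInter fun φ => isClosed_iInter fun hφ => isClosed_iInter fun i =>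
    isClosed_iInter fun j => isClosed_eq ?_ ?_
  · exact (continuous_setIntegral_coord_mul i (hφ.memLp_partialDeriv j)).comp
      (WithLp.fstL 2 ℝ (HVec Ω) (HGrad Ω)).continuous
  · exact ((continuous_setIntegral_coord_mul (i, j) hφ.memLp).comp
      (WithLp.sndL 2 ℝ (HVec Ω) (HGrad Ω)).continuous).neg

theorem HasZeroTraceOn.exists_approx {z : HVec Ω} {G : HGrad Ω} (h : HasZeroTraceOn Ω ΓD z G)
    {ε : ℝ≥0∞} (hε : 0 < ε) :
    ∃ φ : E3 → E3, ContDiff ℝ ∞ φ ∧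
      eLpNorm (fun x => φ x - z x) 2 (volume.restrict Ω) < ε ∧
      eLpNorm (fun x => jacobian φ x - G x) 2 (volume.restrict Ω) < ε ∧
      eLpNorm φ 2 ((μH[2] : Measure E3).restrict ΓD) < ε := by
  obtain ⟨φ, hφ, hz, hG, hD⟩ := h
  obtain ⟨m, hm⟩ := ((hz.eventually_lt_const hε).and
    ((hG.eventually_lt_const hε).and (hD.eventually_lt_const hε))).exists
  exact ⟨φ m, hφ m, hm⟩

theorem HasZeroTraceOn.of_tendsto {z : ℕ → HVec Ω} {G : ℕ → HGrad Ω} {z₀ : HVec Ω}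
    {G₀ : HGrad Ω} (h : ∀ n, HasZeroTraceOn Ω ΓD (z n) (G n)) (hz : Tendsto z atTop (𝓝 z₀))
    (hG : Tendsto G atTop (𝓝 G₀)) : HasZeroTraceOn Ω ΓD z₀ G₀ := by
  choose φ hφ hφz hφG hφD using fun n : ℕ => (h n).exists_approx
    (ENNReal.inv_pos.2 (ENNReal.natCast_ne_top n))
  have hlim : ∀ {a : ℕ → ℝ≥0∞}, (∀ n, a n < (n : ℝ≥0∞)⁻¹) → Tendsto a atTop (𝓝 0) := fun ha =>
    tendsto_of_tendsto_of_tendsto_of_le_of_le tendsto_const_nhds ENNReal.tendsto_inv_nat_nhds_zero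
      (fun _ => zero_le) fun n => (ha n).le
  refine ⟨φ, hφ, ?_, ?_, hlim hφD⟩
  · refine tendsto_eLpNorm_add (a := fun n x => φ n x - z n x) (b := fun n => ⇑(z n) - ⇑z₀)
      (fun n => (hφ n).continuous.aestronglyMeasurable.sub (Lp.aestronglyMeasurable _))
      (fun n => (Lp.aestronglyMeasurable _).sub (Lp.aestronglyMeasurable _))
      (fun n => ae_of_all _ fun x => ?_) (hlim hφz)
      ((Lp.tendsto_Lp_iff_tendsto_eLpNorm' _ _).1 hz)
    simp
  · refine tendsto_eLpNorm_add (a := fun n x => jacobian (φ n) x - G n x)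
      (b := fun n => ⇑(G n) - ⇑G₀)
      (fun n => (continuous_jacobian (hφ n)).aestronglyMeasurable.sub (Lp.aestronglyMeasurable _))
      (fun n => (Lp.aestronglyMeasurable _).sub (Lp.aestronglyMeasurable _))
      (fun n => ae_of_all _ fun x => ?_) (hlim hφG)
      ((Lp.tendsto_Lp_iff_tendsto_eLpNorm' _ _).1 hG)
    simp

theorem isClosed_VSub : IsClosed (VSub Ω ΓD : Set (WithLp 2 (HVec Ω × HGrad Ω))) := by
  refine IsSeqClosed.isClosed fun p p₀ hp hlim => ⟨?_, ?_⟩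
  · exact isClosed_hasWeakGrad.mem_of_tendsto hlim (Eventually.of_forall fun n => (hp n).1)
  · exact HasZeroTraceOn.of_tendsto (fun n => (hp n).2)
      (((WithLp.fstL 2 ℝ (HVec Ω) (HGrad Ω)).continuous.tendsto p₀).comp hlim)
      (((WithLp.sndL 2 ℝ (HVec Ω) (HGrad Ω)).continuous.tendsto p₀).comp hlim)

instance : CompleteSpace (VSp Ω ΓD) := isClosed_VSub.completeSpace_coe

theorem isGraphNorm_toH_grad : IsGraphNorm (toH Ω ΓD) (grad Ω ΓD) := fun z =>
  WithLp.prod_norm_sq_eq_of_L2 (z : WithLp 2 (HVec Ω × HGrad Ω))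

theorem IsTest.setIntegral_mul_partialDeriv {ψ φ : E3 → ℝ} (hψ : IsTest Ω ψ)
    (hφ : ContDiff ℝ ∞ φ) (j : Fin 3) :
    ∫ x in Ω, φ x * partialDeriv ψ j x = -∫ x in Ω, partialDeriv φ j x * ψ x := by
  have hsupp : ∀ x, x ∉ Ω → ψ x = 0 ∧ fderiv ℝ ψ x = 0 := fun x hx =>
    have hx' : x ∉ tsupport ψ := fun h => hx (hψ.tsupport_subset h)
    ⟨image_eq_zero_of_notMem_tsupport hx', fderiv_of_notMem_tsupport ℝ hx'⟩
  have hcψ : Continuous (partialDeriv ψ j) :=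
    (hψ.smooth.continuous_fderiv (by simp)).clm_apply continuous_const
  have hcφ : Continuous (partialDeriv φ j) :=
    (hφ.continuous_fderiv (by simp)).clm_apply continuous_const
  rw [setIntegral_eq_integral_of_forall_compl_eq_zero fun x hx => by
      simp [partialDeriv, (hsupp x hx).2],
    setIntegral_eq_integral_of_forall_compl_eq_zero fun x hx => by simp [(hsupp x hx).1]]
  exact integral_mul_fderiv_eq_neg_fderiv_mul_of_integrable
    ((hcφ.mul hψ.smooth.continuous).integrable_of_hasCompactSupport hψ.hasCompactSupport.mul_left)
    ((hφ.continuous.mul hcψ).integrable_of_hasCompactSupport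
      (hψ.hasCompactSupport.fderiv_apply ℝ _).mul_left)
    ((hφ.continuous.mul hψ.smooth.continuous).integrable_of_hasCompactSupport
      hψ.hasCompactSupport.mul_left)
    (fun x _ => hφ.differentiable (by simp) x) fun x _ => hψ.smooth.differentiable (by simp) x

theorem jacobian_apply {φ : E3 → E3} (hφ : ContDiff ℝ ∞ φ) (x : E3) (i j : Fin 3) :
    jacobian φ x (i, j) = partialDeriv (fun y => φ y i) j x := by
  have h := ((EuclideanSpace.proj (𝕜 := ℝ) i : E3 →L[ℝ] ℝ).hasFDerivAt.comp x
    (hφ.differentiable (by simp) x).hasFDerivAt).fderiv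
  exact (DFunLike.congr_fun h (EuclideanSpace.single j 1)).symm

section SmoothField

variable {φ : E3 → E3} (hφ : ContDiff ℝ ∞ φ) (hm : MemLp φ 2 (volume.restrict Ω))
  (hmj : MemLp (jacobian φ) 2 (volume.restrict Ω))

include hφ

theorem hasWeakGrad_toLp_jacobian : HasWeakGrad Ω (hm.toLp φ) (hmj.toLp (jacobian φ)) := by
  intro ψ hψ i j
  have hcoord : ContDiff ℝ ∞ fun x => φ x i :=
    (EuclideanSpace.proj (𝕜 := ℝ) i : E3 →L[ℝ] ℝ).contDiff.comp hφ
  calc ∫ x in Ω, hm.toLp φ x i * partialDeriv ψ j x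
      = ∫ x in Ω, φ x i * partialDeriv ψ j x :=
        integral_congr_ae (hm.coeFn_toLp.mono fun x hx => by simp only [hx])
    _ = -∫ x in Ω, partialDeriv (fun y => φ y i) j x * ψ x :=
        hψ.setIntegral_mul_partialDeriv hcoord j
    _ = -∫ x in Ω, hmj.toLp (jacobian φ) x (i, j) * ψ x :=
        congrArg _ (integral_congr_ae (hmj.coeFn_toLp.mono fun x hx => by
          simp only [hx, jacobian_apply hφ]))

theorem hasZeroTraceOn_toLp_jacobian (hzero : ∀ x ∈ ΓD, φ x = 0) :
    HasZeroTraceOn Ω ΓD (hm.toLp φ) (hmj.toLp (jacobian φ)) := by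
  have hlim : ∀ {F : Type} [NormedAddCommGroup F] {f : E3 → F} {μ : Measure E3}, f =ᵐ[μ] 0 →
      Tendsto (fun _ : ℕ => eLpNorm f 2 μ) atTop (𝓝 0) := fun hf => by
    simp only [eLpNorm_congr_ae hf, eLpNorm_zero, tendsto_const_nhds_iff]
  refine ⟨fun _ => φ, fun _ => hφ, hlim ?_, hlim ?_, hlim ?_⟩
  · exact hm.coeFn_toLp.mono fun x hx => by simp [hx]
  · exact hmj.coeFn_toLp.mono fun x hx => by simp [hx]
  · exact (ae_restrict_iff (isClosed_eq hφ.continuous continuous_const).measurableSet).2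
      (ae_of_all _ hzero)

theorem exists_VSp_of_hasCompactSupport (hc : HasCompactSupport φ) (hzero : ∀ x ∈ ΓD, φ x = 0) :
    ∃ z : VSp Ω ΓD, toH Ω ΓD z =ᵐ[volume.restrict Ω] φ := by
  have hcj : HasCompactSupport (jacobian φ) := (hc.fderiv ℝ).mono fun x hx h0 => hx <| by
    ext p
    simp [jacobian, h0]
  have hm : MemLp φ 2 (volume.restrict Ω) := hφ.continuous.memLp_of_hasCompactSupport hc
  have hmj : MemLp (jacobian φ) 2 (volume.restrict Ω) :=
    (continuous_jacobian hφ).memLp_of_hasCompactSupport hcj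
  exact ⟨⟨WithLp.toLp 2 (hm.toLp φ, hmj.toLp (jacobian φ)), hasWeakGrad_toLp_jacobian hφ hm hmj,
    hasZeroTraceOn_toLp_jacobian hφ hm hmj hzero⟩, hm.coeFn_toLp⟩

end SmoothField

theorem eq_zero_of_inner_toH (hΩ : IsOpen Ω) (hΓ : ΓD ⊆ frontier Ω) {u : HVec Ω}
    (hu : ∀ z, inner ℝ u (toH Ω ΓD z) = 0) : u = 0 := by
  have hcoord : ∀ k : Fin 3, ∀ᵐ x ∂(volume.restrict Ω), x ∈ Ω → u x k = 0 := fun k => by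
    refine hΩ.ae_eq_zero_of_integral_contDiff_smul_eq_zero
      (((memLp_coord u k).locallyIntegrable (by norm_num)).locallyIntegrableOn Ω)
      fun φ hφ hc hsupp => ?_
    obtain ⟨z, hz⟩ := exists_VSp_of_hasCompactSupport (Ω := Ω) (ΓD := ΓD)
      (φ := fun x => φ x • EuclideanSpace.single k 1) (hφ.smul contDiff_const) hc.smul_right
      fun x hx => by
        have hxΩ : x ∉ Ω := (hΩ.frontier_eq ▸ hΓ hx : x ∈ closure Ω \ Ω).2
        simp only [image_eq_zero_of_notMem_tsupport fun h => hxΩ (hsupp h), zero_smul]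
    rw [← hu z, L2.inner_def]
    refine integral_congr_ae (hz.mono fun x hx => ?_)
    simp only [hx, inner_smul_right, EuclideanSpace.inner_single_right]
    simp
  refine Lp.ext ?_
  filter_upwards [ae_all_iff.2 hcoord, self_mem_ae_restrict hΩ.measurableSet,
    Lp.coeFn_zero E3 2 (volume.restrict Ω)] with x hx hxΩ h0
  rw [h0]
  ext k
  exact hx k hxΩ

theorem injective_adjoint_toH (hΩ : IsOpen Ω) (hΓ : ΓD ⊆ frontier Ω) :
    Function.Injective (toH Ω ΓD).adjoint := by
  refine (injective_iff_map_eq_zero _).2 fun u hu => eq_zero_of_inner_toH hΩ hΓ fun z => ?_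
  rw [← ContinuousLinearMap.adjoint_inner_left, hu, inner_zero_left]

end VelocitySpace

/-! ## The yield sets -/

section YieldSet

variable {Ω : Set E3}

/-- The deviator as a continuous linear map. -/
def deviatorCLM : SymTensor →L[ℝ] Tensor :=
  LinearMap.toContinuousLinearMap
    { toFun := deviator
      map_add' := fun a b => by
        ext p
        have h : ∀ q, (a + b).toTensor q = a.toTensor q + b.toTensor q := fun _ => rfl
        simp only [deviator, h, Finset.sum_add_distrib, PiLp.add_apply]
        ring
      map_smul' := fun c a => by
        ext p
        have h : ∀ q, (c • a).toTensor q = c * a.toTensor q := fun _ => rfl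
        simp only [deviator, h, ← Finset.mul_sum, PiLp.smul_apply, smul_eq_mul, RingHom.id_apply]
        ring }

theorem convexOn_deviator_sq :
    ConvexOn ℝ univ fun τ : SymTensor => (1 / 2 : ℝ) * ‖deviator τ‖ ^ 2 :=
  (((convexOn_univ_norm (E := Tensor)).comp_linearMap deviatorCLM.toLinearMap).pow
    (fun _ _ => norm_nonneg _) 2).smul (by norm_num)

theorem continuous_deviator_sq :
    Continuous fun τ : SymTensor => (1 / 2 : ℝ) * ‖deviator τ‖ ^ 2 :=
  (deviatorCLM.continuous.norm.pow 2).const_mul _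

theorem isClosed_Ktilde :
    IsClosed {p : HSym Ω × (closure Ω →ᵇ ℝ) | p.1 ∈ Ktilde Ω p.2} := by
  refine IsSeqClosed.isClosed fun p p₀ hp hlim => ?_
  have hlim₁ : Tendsto (fun n => (p n).1) atTop (𝓝 p₀.1) := (continuous_fst.tendsto p₀).comp hlim
  have hlim₂ : Tendsto (fun n => (p n).2) atTop (𝓝 p₀.2) := (continuous_snd.tendsto p₀).comp hlim
  obtain ⟨φ, hφ, hφt⟩ := (tendstoInMeasure_of_tendsto_Lp hlim₁).exists_seq_tendsto_ae
  filter_upwards [hφt, ae_all_iff.2 hp] with x hx hyield hxΩ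
  exact le_of_tendsto_of_tendsto' ((continuous_deviator_sq.tendsto _).comp hx)
    (((BoundedContinuousFunction.lipschitz_eval_const _).continuous.tendsto _).comp
      (hlim₂.comp hφ.tendsto_atTop)) fun n => hyield (φ n) hxΩ

theorem convex_Ktilde : Convex ℝ {p : HSym Ω × (closure Ω →ᵇ ℝ) | p.1 ∈ Ktilde Ω p.2} := by
  rintro ⟨τ, γ⟩ hτ ⟨τ', γ'⟩ hτ' a b ha hb hab
  filter_upwards [hτ, hτ', Lp.coeFn_add (a • τ) (b • τ'), Lp.coeFn_smul a τ, Lp.coeFn_smul b τ']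
    with x hx hx' hadd ha' hb' hxΩ
  simp only [Prod.smul_mk, Prod.mk_add_mk] at hadd ⊢
  rw [hadd, Pi.add_apply, ha', hb']
  exact (convexOn_deviator_sq.2 (mem_univ _) (mem_univ _) ha hb hab).trans
    (add_le_add (mul_le_mul_of_nonneg_left (hx hxΩ) ha) (mul_le_mul_of_nonneg_left (hx' hxΩ) hb))

theorem monotone_Ktilde : Monotone (Ktilde Ω) := fun _ _ hγ τ hτ => by
  rw [Ktilde, mem_ofPred_eq] at hτ ⊢
  exact hτ.mono fun x hx hxΩ => (hx hxΩ).trans (hγ _)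

theorem zero_mem_Ktilde {γ : closure Ω →ᵇ ℝ} (hγ : 0 ≤ γ) : (0 : HSym Ω) ∈ Ktilde Ω γ := by
  filter_upwards [Lp.coeFn_zero SymTensor 2 (volume.restrict Ω)] with x hx hxΩ
  have hdev : deviator (0 : SymTensor) = 0 := deviatorCLM.map_zero
  rw [hx, Pi.zero_apply, hdev]
  simpa using hγ _

theorem smul_mem_Ktilde {γ γ' : closure Ω →ᵇ ℝ} {r : ℝ} (hr : r ∈ Icc 0 1) (hγ : r • γ' ≤ γ)
    {τ : HSym Ω} (hτ : τ ∈ Ktilde Ω γ') : r • τ ∈ Ktilde Ω γ :=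
  monotone_Ktilde hγ (convex_Ktilde.smul_mem_of_zero_mem (x := (τ, γ')) (zero_mem_Ktilde le_rfl)
    hτ hr)

theorem smul_mem_Ktilde_of_mem_add_smul_one {γ : closure Ω →ᵇ ℝ} {κ c : ℝ} (hκ : 0 < κ)
    (hγ : ∀ x, κ ≤ γ x) (hc : 0 ≤ c) {τ : HSym Ω}
    (hτ : τ ∈ Ktilde Ω (γ + c • 1)) :
    (κ / (κ + c)) • τ ∈ Ktilde Ω γ := by
  have hd : 0 < κ + c := by linarith
  refine smul_mem_Ktilde ⟨by positivity, div_le_one_of_le₀ (by linarith) hd.le⟩ (fun x => ?_) hτ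
  change κ / (κ + c) * (γ x + c * 1) ≤ γ x
  rw [mul_one, div_mul_eq_mul_div, div_le_iff₀ hd]
  nlinarith [mul_le_mul_of_nonneg_right (hγ x) hc]

theorem isSweepingFamily_Ktilde {T κ : ℝ} {g g' : ℝ → (closure Ω →ᵇ ℝ)}
    (hg : HasH1Deriv T g g') (hκ : 0 < κ) (hgκ : ∀ t ∈ Icc 0 T, ∀ x, κ ≤ g t x) :
    IsSweepingFamily T κ (hg.1.norm.toLp _)
      fun t c => Ktilde Ω (g t + c • 1) where
  pos := hκ
  monotone_primitive s hs t ht hst := by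
    have hws := (intervalIntegrable_of_integrable hg.integrable hs).norm
    have hwt := (intervalIntegrable_of_integrable hg.integrable ht).norm
    simp only [primitive_toLp hg.1.norm hs, primitive_toLp hg.1.norm ht]
    rw [← sub_nonneg, intervalIntegral.integral_interval_sub_left hwt hws]
    exact intervalIntegral.integral_nonneg hst fun _ _ => norm_nonneg _
  isClosed t _ := isClosed_Ktilde.preimage (f := fun p : HSym Ω × ℝ => (p.1, g t + p.2 • 1))
    (by fun_prop)
  convex t _ := by
    rintro ⟨τ, c⟩ hτ ⟨τ', c'⟩ hτ' a b ha hb hab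
    have hmix : a • (g t + c • 1) + b • (g t + c' • 1) = g t + (a • c + b • c') • 1 :=
      calc _ = (a + b) • g t + (a • c + b • c') • 1 := by module
        _ = _ := by rw [hab, one_smul]
    simpa only [Prod.smul_mk, Prod.mk_add_mk, hmix, mem_ofPred_eq] using convex_Ktilde
      (x := (τ, g t + c • 1)) hτ (y := (τ', g t + c' • 1)) hτ' ha hb hab
  zero_mem t ht := zero_mem_Ktilde fun x => by
    simpa using hκ.le.trans (hgκ t ht x)
  mono t _ c c' hc := monotone_Ktilde fun x => by simpa using hc
  shift s hs t ht := monotone_Ktilde fun x => by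
    have h := ((le_abs_self _).trans ((g s - g t).norm_coe_le_norm x)).trans
      (hg.norm_sub_le hs ht)
    rw [← primitive_toLp hg.1.norm hs, ← primitive_toLp hg.1.norm ht,
      BoundedContinuousFunction.sub_apply] at h
    change g s x + 0 * 1 ≤ g t x + |_| * 1
    linarith
  scale t ht c hc τ hτ := by
    simpa only [zero_smul, add_zero] using smul_mem_Ktilde_of_mem_add_smul_one hκ (hgκ t ht) hc hτ

end YieldSet

/-! ## The coupled system -/

section MovingSets

variable {X : Type*} [NormedAddCommGroup X] [InnerProductSpace ℝ X] {T κ : ℝ} {ρ : TimeL2 T ℝ}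
  {K : ℝ → ℝ → Set X}

theorem IsSweepingFamily.forall_mem (h : IsSweepingFamily T κ ρ K) (hT : 0 < T) {σ : ℝ → X}
    (hσ : ContinuousOn σ (Icc 0 T)) (hK : ∀ᵐ t ∂(timeMeasure T), σ t ∈ K t 0) :
    ∀ t ∈ Icc 0 T, σ t ∈ K t 0 := by
  intro t ht
  have hmem := forall_mem_of_ae_mem (E := X × ℝ) hT (h.isClosed t ht)
    ⟨((0 : X), (0 : ℝ)), h.zero_mem t ht⟩
    (u := fun s => (σ s, |primitive T ℝ t ρ - primitive T ℝ s ρ|))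
    (hσ.prodMk (continuousOn_const.sub (continuousOn_primitive ρ)).abs) ?_ t ht
  · simpa using hmem
  · filter_upwards [hK, ae_timeMeasure_mem T] with s hs hsT
    exact h.shift s (Ioo_subset_Icc_self hsT) t ht hs

end MovingSets

section Const

variable {V W : Type*} [NormedAddCommGroup V] [InnerProductSpace ℝ V] [NormedAddCommGroup W]
  [InnerProductSpace ℝ W] {T : ℝ}

theorem lift_const (L : V →L[ℝ] W) (a : V) :
    lift T L (Lp.const 2 (timeMeasure T) a) = Lp.const 2 (timeMeasure T) (L a) := by
  refine Lp.ext ?_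
  filter_upwards [L.coeFn_compLpL (Lp.const 2 (timeMeasure T) a),
    Lp.coeFn_const (p := 2) (μ := timeMeasure T) a,
    Lp.coeFn_const (p := 2) (μ := timeMeasure T) (L a)] with t hL ha hLa
  rw [hL, ha, hLa, Function.const_apply, Function.const_apply]

end Const

section Coupled

variable {V H W X : Type*} [NormedAddCommGroup V] [InnerProductSpace ℝ V] [CompleteSpace V]
  [NormedAddCommGroup H] [InnerProductSpace ℝ H] [CompleteSpace H]
  [NormedAddCommGroup W] [InnerProductSpace ℝ W] [CompleteSpace W]
  [NormedAddCommGroup X] [InnerProductSpace ℝ X] [CompleteSpace X] {T ν : ℝ}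
  {i : V →L[ℝ] H} {D : V →L[ℝ] W} {e : V →L[ℝ] X} {v₀ : H} {σ₀ : X}

/-- The velocity derivative prescribed by the equation of motion `v' + ν D*D u + e*σ = F`. -/
def acceleration (D : V →L[ℝ] W) (e : V →L[ℝ] X) (ν : ℝ) (F u : TimeL2 T V) (x : TimeL2 T X) :
    TimeL2 T V :=
  F - ν • lift T D.adjoint (lift T D u) - lift T e.adjoint x

/-- The viscous plasticity system in abstract Hilbert spaces, integrated in time, for `u` in
`L²(0,T;V)` and the stress rate `w`. Functionals on `V` are represented by elements of `V`. -/
structure IsIntegratedSol (i : V →L[ℝ] H) (D : V →L[ℝ] W) (e : V →L[ℝ] X) (ν : ℝ)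
    (F : TimeL2 T V) (h : TimeL2 T X) (M : ℝ → Set X) (v₀ : H) (σ₀ : X) (u : TimeL2 T V)
    (w : TimeL2 T X) : Prop where
  motion : lift T i.adjoint (lift T i u)
    = trajectory (i.adjoint v₀) (acceleration D e ν F u (trajectory σ₀ w))
  flow : IsSweepingSol M 0 0 (lift T e u + h) σ₀ (trajectory σ₀ w) w

section Integrated

variable {F : TimeL2 T V} {h : TimeL2 T X} {M : ℝ → Set X} {u u₁ u₂ : TimeL2 T V}
  {w w₁ w₂ : TimeL2 T X}

theorem IsIntegratedSol.isParabolicSol_sub (h₁ : IsIntegratedSol i D e ν F h M v₀ σ₀ u₁ w₁)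
    (h₂ : IsIntegratedSol i D e ν F h M v₀ σ₀ u₂ w₂) :
    IsParabolicSol i D ν (-lift T e.adjoint (volterra T X (w₁ - w₂))) (u₁ - u₂) := by
  have hx : trajectory σ₀ w₁ - trajectory σ₀ w₂ = volterra T X (w₁ - w₂) := by
    rw [trajectory_sub, sub_self, trajectory_zero]
  rw [IsParabolicSol, map_sub, map_sub, h₁.motion, h₂.motion, trajectory_sub, sub_self,
    trajectory_zero, ← hx]
  refine congrArg _ ?_
  simp only [acceleration, map_sub, smul_sub]
  abel

theorem IsIntegratedSol.inner_cutoff_sub_nonpos (h₁ : IsIntegratedSol i D e ν F h M v₀ σ₀ u₁ w₁)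
    (h₂ : IsIntegratedSol i D e ν F h M v₀ σ₀ u₂ w₂) (t : ℝ) :
    inner ℝ (w₁ - w₂ - lift T e (u₁ - u₂)) (cutoff T X t (volterra T X (w₁ - w₂))) ≤ 0 := by
  have hflow₁ := h₁.flow.variational _ (add_cutoff_sub_mem_selections h₁.flow.mem h₂.flow.mem t)
  have hflow₂ := h₂.flow.variational _ (add_cutoff_sub_mem_selections h₂.flow.mem h₁.flow.mem t)
  rw [sub_add_cancel_left, trajectory_sub, sub_self, trajectory_zero, ← map_neg, ← map_neg,
    neg_sub] at hflow₁ hflow₂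
  rw [← neg_sub w₁ w₂, map_neg, map_neg, inner_neg_right, ← inner_neg_left] at hflow₂
  refine le_trans (le_of_eq ?_) (add_nonpos hflow₁ hflow₂)
  rw [← inner_add_left]
  congr 1
  simp only [zero_apply, map_sub]
  abel

theorem IsIntegratedSol.unique (hT : 0 < T) (hν : 0 < ν) (hnorm : IsGraphNorm i D)
    (h₁ : IsIntegratedSol i D e ν F h M v₀ σ₀ u₁ w₁)
    (h₂ : IsIntegratedSol i D e ν F h M v₀ σ₀ u₂ w₂) : u₁ = u₂ ∧ w₁ = w₂ := by
  obtain ⟨S, hS, hSmono, -⟩ := exists_parabolicOperator (i := i) (D := D) hT hν hnorm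
  set w := w₁ - w₂
  have hu : u₁ - u₂ = -S (lift T e.adjoint (volterra T X w)) := by
    rw [← map_neg]
    exact (h₁.isParabolicSol_sub h₂).unique hT hν hnorm (hS _)
  have hprim : ∀ t ∈ Icc 0 T, primitive T X t w = 0 := fun t ht => by
    have hflow := h₁.inner_cutoff_sub_nonpos h₂ t
    have hmono := hSmono.conj e t ht (volterra T X w)
    rw [hu, map_neg, sub_neg_eq_add, inner_add_left, inner_cutoff_right,
      inner_cutoff_volterra w ht] at hflow
    rw [real_inner_comm, ContinuousLinearMap.comp_apply, ContinuousLinearMap.comp_apply] at hmono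
    exact norm_eq_zero.1 (sq_eq_zero_iff.1 (le_antisymm (by linarith) (sq_nonneg _)))
  have hw : w = 0 := eq_zero_of_primitive_eq_zero hprim
  rw [hw, map_zero, map_zero, map_zero, neg_zero] at hu
  exact ⟨sub_eq_zero.1 hu, sub_eq_zero.1 hw⟩

theorem exists_isIntegratedSol (hT : 0 < T) (hν : 0 < ν) (hnorm : IsGraphNorm i D) {κ : ℝ}
    {ρ : TimeL2 T ℝ} {K : ℝ → ℝ → Set X} (hK : IsSweepingFamily T κ ρ K) (F : TimeL2 T V)
    (h : TimeL2 T X) (v₀ : V) (hσ₀ : σ₀ ∈ K 0 0) :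
    ∃ u w, IsIntegratedSol i D e ν F h (K · 0) (i v₀) σ₀ u w ∧
      ∃ C, ∀ t ∈ Icc 0 T, ∃ v : H, ‖v‖ ≤ C ∧ i.adjoint v = i.adjoint (i v₀)
        + primitive T V t (acceleration D e ν F u (trajectory σ₀ w)) := by
  obtain ⟨S, hS, hSmono, hSbound⟩ := exists_parabolicOperator (i := i) (D := D) hT hν hnorm
  set c : TimeL2 T V := Lp.const 2 (timeMeasure T) v₀
  set G : TimeL2 T V := F - ν • lift T D.adjoint (lift T D c)
  obtain ⟨w, hw⟩ := exists_isSweepingSol hK hT.le (hSmono.conj e) hσ₀ (h + lift T e (c + S G))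
  set x := trajectory σ₀ w
  set y : TimeL2 T V := S (G - lift T e.adjoint x)
  have hacc : G - lift T e.adjoint x - ν • lift T D.adjoint (lift T D y)
      = acceleration D e ν F (c + y) x := by
    simp only [G, acceleration, map_add, smul_add]
    abel
  refine ⟨c + y, w, ⟨?_, hw.mem, hw.position, fun τ hτ => ?_⟩, ?_⟩
  · rw [map_add, map_add, lift_const, lift_const, trajectory, ← hacc]
    exact congrArg _ (hS _)
  · convert hw.variational τ hτ using 2
    simp only [y, zero_apply, ContinuousLinearMap.comp_apply, map_add, map_sub]
    abel
  · obtain ⟨C, hC⟩ := hSbound (G - lift T e.adjoint x)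
    refine ⟨‖i v₀‖ + C, fun t ht => ?_⟩
    obtain ⟨v, hv, hiv⟩ := hC t ht
    exact ⟨i v₀ + v, (norm_add_le _ _).trans (by gcongr), by rw [map_add, hiv, hacc]⟩

end Integrated

theorem coeFn_acceleration (D : V →L[ℝ] W) (e : V →L[ℝ] X) (ν : ℝ) (F u : TimeL2 T V)
    (x : TimeL2 T X) : acceleration D e ν F u x =ᵐ[timeMeasure T]
      fun t => F t - ν • D.adjoint (D (u t)) - e.adjoint (x t) := by
  filter_upwards [Lp.coeFn_sub (F - ν • lift T D.adjoint (lift T D u)) (lift T e.adjoint x),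
    Lp.coeFn_sub F (ν • lift T D.adjoint (lift T D u)),
    Lp.coeFn_smul ν (lift T D.adjoint (lift T D u)), D.adjoint.coeFn_compLpL (lift T D u),
    D.coeFn_compLpL u, e.adjoint.coeFn_compLpL x] with t hsub₁ hsub₂ hsmul hD' hD he
  rw [acceleration, hsub₁, Pi.sub_apply, hsub₂, Pi.sub_apply, hsmul, Pi.smul_apply, hD', hD, he]

/-- The viscous plasticity system in abstract Hilbert spaces, pointwise in time: the counterpart of
`IsSolution` with `i`, `D`, `e` for the inclusion in `L²`, the gradient and the strain.
Functionals on `V` are represented by elements of `V`, `v'` and the force `F` included. -/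
structure IsCoupledSolution (T ν : ℝ) (i : V →L[ℝ] H) (D : V →L[ℝ] W) (e : V →L[ℝ] X)
    (F : ℝ → V) (h : ℝ → X) (M : ℝ → Set X) (v₀ : H) (σ₀ : X) (v : ℝ → H) (σ : ℝ → X)
    (u v' : ℝ → V) (σ' : ℝ → X) : Prop where
  velocity_deriv : HasH1Deriv T (fun t => i.adjoint (v t)) v'
  velocity_bounded : MemLp v ∞ (timeMeasure T)
  velocity_memLp : MemLp u 2 (timeMeasure T)
  velocity_eq : ∀ᵐ t ∂(timeMeasure T), v t = i (u t)
  stress_deriv : HasH1Deriv T σ σ'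
  stress_mem : ∀ t ∈ Icc 0 T, σ t ∈ M t
  motion : ∀ᵐ t ∂(timeMeasure T), v' t + ν • D.adjoint (D (u t)) + e.adjoint (σ t) = F t
  flow : ∀ᵐ t ∂(timeMeasure T), ∀ τ ∈ M t, inner ℝ (σ' t - e (u t) - h t) (σ t - τ) ≤ 0
  velocity_zero : v 0 = v₀
  stress_zero : σ 0 = σ₀

variable {F : ℝ → V} {h : ℝ → X} {M : ℝ → Set X} {v v₁ v₂ : ℝ → H} {σ σ' σ₁ σ₂ σ₁' σ₂' : ℝ → X}
  {u v' u₁ u₂ v₁' v₂' : ℝ → V}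

namespace IsCoupledSolution

section ToIntegrated

variable (hs : IsCoupledSolution T ν i D e F h M v₀ σ₀ v σ u v' σ')
  (hF : MemLp F 2 (timeMeasure T)) (hh : MemLp h 2 (timeMeasure T))
include hs

theorem toLp_deriv_eq_acceleration :
    hs.velocity_deriv.1.toLp v' = acceleration D e ν (hF.toLp F) (hs.velocity_memLp.toLp u)
      (trajectory σ₀ (hs.stress_deriv.1.toLp σ')) := by
  refine Lp.ext ?_
  filter_upwards [hs.velocity_deriv.1.coeFn_toLp, hF.coeFn_toLp, hs.velocity_memLp.coeFn_toLp,
    hs.stress_deriv.coeFn_trajectory hs.stress_zero, hs.motion,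
    coeFn_acceleration D e ν (hF.toLp F) (hs.velocity_memLp.toLp u)
      (trajectory σ₀ (hs.stress_deriv.1.toLp σ'))]
    with t hv' hFt hu hσ hmotion hacc
  rw [hacc, hv', hFt, hu, hσ, ← hmotion]
  abel

theorem lift_adjoint_lift_eq : lift T i.adjoint (lift T i (hs.velocity_memLp.toLp u))
    = trajectory (i.adjoint v₀) (hs.velocity_deriv.1.toLp v') := by
  refine Lp.ext ?_
  filter_upwards [hs.velocity_deriv.coeFn_trajectory (congrArg _ hs.velocity_zero), hs.velocity_eq,
    hs.velocity_memLp.coeFn_toLp, i.coeFn_compLpL (hs.velocity_memLp.toLp u),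
    i.adjoint.coeFn_compLpL (lift T i (hs.velocity_memLp.toLp u))] with t htraj hv hu hi hi'
  rw [hi', hi, hu, ← hv, ← htraj]

theorem isIntegratedSol : IsIntegratedSol i D e ν (hF.toLp F) (hh.toLp h) M v₀ σ₀
    (hs.velocity_memLp.toLp u) (hs.stress_deriv.1.toLp σ') := by
  refine ⟨by rw [hs.lift_adjoint_lift_eq, hs.toLp_deriv_eq_acceleration hF], ?_, ?_, ?_⟩
  · filter_upwards [hs.stress_deriv.coeFn_trajectory hs.stress_zero, ae_timeMeasure_mem T]
      with t hσ ht
    exact hσ ▸ hs.stress_mem t (Ioo_subset_Icc_self ht)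
  · rw [zero_smul, add_zero]
  · intro τ hτ
    rw [zero_apply, add_zero, L2.inner_def]
    refine integral_nonpos_of_ae ?_
    set w := hs.stress_deriv.1.toLp σ'
    set y := hs.velocity_memLp.toLp u
    filter_upwards [hs.flow, hτ, hs.stress_deriv.coeFn_trajectory hs.stress_zero,
      hs.stress_deriv.1.coeFn_toLp, hs.velocity_memLp.coeFn_toLp, hh.coeFn_toLp,
      Lp.coeFn_sub w (lift T e y + hh.toLp h), Lp.coeFn_add (lift T e y) (hh.toLp h),
      e.coeFn_compLpL y, Lp.coeFn_sub (trajectory σ₀ w) τ]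
      with t hflow hτt hσ hw hy hht hsub hadd he hsub'
    rw [hsub, hsub', Pi.sub_apply, Pi.sub_apply, hadd, Pi.add_apply, he, hσ, hw, hy, hht,
      ← sub_sub]
    exact hflow _ hτt

end ToIntegrated

theorem unique (hT : 0 < T) (hν : 0 < ν) (hnorm : IsGraphNorm i D)
    (hi : Function.Injective i.adjoint) (hF : MemLp F 2 (timeMeasure T))
    (hh : MemLp h 2 (timeMeasure T))
    (h₁ : IsCoupledSolution T ν i D e F h M v₀ σ₀ v₁ σ₁ u₁ v₁' σ₁')
    (h₂ : IsCoupledSolution T ν i D e F h M v₀ σ₀ v₂ σ₂ u₂ v₂' σ₂') :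
    ∀ t ∈ Icc 0 T, v₁ t = v₂ t ∧ σ₁ t = σ₂ t := by
  obtain ⟨hu, hw⟩ := (h₁.isIntegratedSol hF hh).unique hT hν hnorm (h₂.isIntegratedSol hF hh)
  refine fun t ht => ⟨hi ?_, ?_⟩
  · rw [h₁.velocity_deriv.eq_add_primitive (congrArg _ h₁.velocity_zero) ht,
      h₂.velocity_deriv.eq_add_primitive (congrArg _ h₂.velocity_zero) ht,
      h₁.toLp_deriv_eq_acceleration hF, h₂.toLp_deriv_eq_acceleration hF, hu, hw]
  · rw [h₁.stress_deriv.eq_add_primitive h₁.stress_zero ht,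
      h₂.stress_deriv.eq_add_primitive h₂.stress_zero ht, hw]

theorem translate {s s' : ℝ → X} (hs : HasH1Deriv T s s')
    (h₀ : IsCoupledSolution T ν i D e (fun t => F t + e.adjoint (s t)) (fun t => h t + s' t) M
      v₀ (σ₀ + s 0) v σ u v' σ') :
    IsCoupledSolution T ν i D e F h (fun t => {τ | τ + s t ∈ M t}) v₀ σ₀ v (fun t => σ t - s t)
      u v' fun t => σ' t - s' t where
  velocity_deriv := h₀.velocity_deriv
  velocity_bounded := h₀.velocity_bounded
  velocity_memLp := h₀.velocity_memLp
  velocity_eq := h₀.velocity_eq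
  stress_deriv := h₀.stress_deriv.sub hs
  stress_mem t ht := by
    rw [mem_ofPred_eq, sub_add_cancel]
    exact h₀.stress_mem t ht
  motion := by
    filter_upwards [h₀.motion] with t ht
    rw [map_sub, add_sub_assoc', ht, add_sub_cancel_right]
  flow := by
    filter_upwards [h₀.flow] with t ht τ hτ
    convert ht _ hτ using 2 <;> abel
  velocity_zero := h₀.velocity_zero
  stress_zero := by rw [h₀.stress_zero, add_sub_cancel_right]

end IsCoupledSolution

section FromIntegrated

variable {κ : ℝ} {ρ : TimeL2 T ℝ} {K : ℝ → ℝ → Set X} {F' y : TimeL2 T V} {h' w : TimeL2 T X}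
  (hs : IsIntegratedSol i D e ν F' h' (K · 0) v₀ σ₀ y w)
include hs

theorem IsIntegratedSol.ae_eq_of_adjoint_eq (hi : Function.Injective i.adjoint)
    (hv : ∀ t ∈ Icc 0 T, i.adjoint (v t)
      = i.adjoint v₀ + primitive T V t (acceleration D e ν F' y (trajectory σ₀ w))) :
    ∀ᵐ t ∂(timeMeasure T), v t = i (y t) := by
  filter_upwards [i.coeFn_compLpL y, i.adjoint.coeFn_compLpL (lift T i y),
    coeFn_trajectory (i.adjoint v₀) (acceleration D e ν F' y (trajectory σ₀ w)),
    ae_timeMeasure_mem T] with t hiy hi' htraj ht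
  refine hi ?_
  rw [hv t (Ioo_subset_Icc_self ht), ← htraj, ← hs.motion, hi', hiy]

theorem IsIntegratedSol.ae_flow (hK : IsSweepingFamily T κ ρ K) :
    ∀ᵐ t ∂(timeMeasure T), ∀ τ ∈ K t 0,
      inner ℝ (w t - e (y t) - h' t) (σ₀ + primitive T X t w - τ) ≤ 0 := by
  filter_upwards [hK.ae_inner_sub_nonpos (continuousOn_const_add_primitive σ₀ w)
      (coeFn_trajectory σ₀ w) hs.flow.mem hs.flow.variational,
    Lp.coeFn_sub w (lift T e y + h'), Lp.coeFn_add (lift T e y) h', e.coeFn_compLpL y]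
    with t hflow hsub hadd he τ hτ
  have hle := hflow τ hτ
  rwa [zero_apply, add_zero, hsub, Pi.sub_apply, hadd, Pi.add_apply, he, ← sub_sub] at hle

theorem IsIntegratedSol.forall_mem (hT : 0 < T) (hK : IsSweepingFamily T κ ρ K) :
    ∀ t ∈ Icc 0 T, σ₀ + primitive T X t w ∈ K t 0 := by
  refine hK.forall_mem hT (continuousOn_const_add_primitive σ₀ w) ?_
  filter_upwards [hs.flow.mem, coeFn_trajectory σ₀ w] with t hmem htraj
  exact htraj ▸ hmem

end FromIntegrated

theorem IsIntegratedSol.isCoupledSolution {κ : ℝ} {ρ : TimeL2 T ℝ} {K : ℝ → ℝ → Set X}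
    {y : TimeL2 T V} {w : TimeL2 T X} {hF : MemLp F 2 (timeMeasure T)}
    {hh : MemLp h 2 (timeMeasure T)}
    (hs : IsIntegratedSol i D e ν (hF.toLp F) (hh.toLp h) (K · 0) v₀ σ₀ y w) (hT : 0 < T)
    (hi : Function.Injective i.adjoint) (hK : IsSweepingFamily T κ ρ K) {C : ℝ}
    (hvC : ∀ t ∈ Icc 0 T, ‖v t‖ ≤ C) (hv : ∀ t ∈ Icc 0 T, i.adjoint (v t) = i.adjoint v₀
      + primitive T V t (acceleration D e ν (hF.toLp F) y (trajectory σ₀ w))) :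
    IsCoupledSolution T ν i D e F h (K · 0) v₀ σ₀ v (fun t => σ₀ + primitive T X t w) y
      (acceleration D e ν (hF.toLp F) y (trajectory σ₀ w)) w where
  velocity_deriv := hasH1Deriv_of_eq_add_primitive hT.le hv
  velocity_bounded := by
    refine MemLp.of_bound ((i.comp_memLp y).aestronglyMeasurable.congr ?_) C ?_
    · exact (hs.ae_eq_of_adjoint_eq hi hv).mono fun _ h => h.symm
    · exact (ae_timeMeasure_mem T).mono fun t ht => hvC t (Ioo_subset_Icc_self ht)
  velocity_memLp := Lp.memLp y
  velocity_eq := hs.ae_eq_of_adjoint_eq hi hv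
  stress_deriv := hasH1Deriv_of_eq_add_primitive hT.le fun _ _ => rfl
  stress_mem := hs.forall_mem hT hK
  motion := by
    filter_upwards [coeFn_acceleration D e ν (hF.toLp F) y (trajectory σ₀ w), hF.coeFn_toLp,
      coeFn_trajectory σ₀ w] with t hacc hFt hσ
    rw [hacc, hFt, hσ]
    abel
  flow := by
    filter_upwards [hs.ae_flow hK, hh.coeFn_toLp] with t hflow hht
    rwa [hht] at hflow
  velocity_zero := by
    refine hi ?_
    rw [hv 0 (left_mem_Icc.2 hT.le), primitive_zero hT.le, add_zero]
  stress_zero := by rw [primitive_zero hT.le, add_zero]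

theorem exists_coupledSolution (hT : 0 < T) (hν : 0 < ν) (hnorm : IsGraphNorm i D)
    (hi : Function.Injective i.adjoint) (hF : MemLp F 2 (timeMeasure T))
    (hh : MemLp h 2 (timeMeasure T)) {s s' : ℝ → X} (hs : HasH1Deriv T s s') {κ : ℝ}
    {ρ : TimeL2 T ℝ} {K : ℝ → ℝ → Set X} (hK : IsSweepingFamily T κ ρ K) (v₀ : V)
    (hσ₀ : σ₀ + s 0 ∈ K 0 0) :
    ∃ v σ u v' σ', IsCoupledSolution T ν i D e F h (fun t => {τ | τ + s t ∈ K t 0}) (i v₀) σ₀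
      v σ u v' σ' := by
  have hF' : MemLp (fun t => F t + e.adjoint (s t)) 2 (timeMeasure T) :=
    hF.add (e.adjoint.comp_memLp' hs.memLp)
  have hh' : MemLp (fun t => h t + s' t) 2 (timeMeasure T) := hh.add hs.1
  obtain ⟨y, w, hyw, C, hC⟩ := exists_isIntegratedSol (e := e) hT hν hnorm hK (hF'.toLp _)
    (hh'.toLp _) v₀ hσ₀
  choose! v hvC hv using hC
  exact ⟨_, _, _, _, _, (hyw.isCoupledSolution hT hi hK hvC hv).translate hs⟩

end Coupled

section Riesz

variable {V : Type*} [NormedAddCommGroup V] [InnerProductSpace ℝ V] [CompleteSpace V] {T : ℝ}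
  {u : ℝ → V}

theorem HasH1Deriv.innerSL {w : ℝ → V} (h : HasH1Deriv T u w) :
    HasH1Deriv T (fun t => innerSL ℝ (u t)) fun t => innerSL ℝ (w t) :=
  h.clm_comp (_root_.innerSL ℝ)

theorem HasH1Deriv.of_innerSL {w : ℝ → StrongDual ℝ V}
    (h : HasH1Deriv T (fun t => _root_.innerSL ℝ (u t)) w) :
    HasH1Deriv T u fun t => (InnerProductSpace.toDual ℝ V).symm (w t) := by
  convert h.clm_comp (Y := V)
    (InnerProductSpace.toDual ℝ V).symm.toContinuousLinearEquiv.toContinuousLinearMap using 2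
  · exact ((InnerProductSpace.toDual ℝ V).symm_apply_apply _).symm
  · rfl

theorem motion_iff {H W X : Type*} [NormedAddCommGroup H] [InnerProductSpace ℝ H]
    [CompleteSpace H] [NormedAddCommGroup W] [InnerProductSpace ℝ W] [CompleteSpace W]
    [NormedAddCommGroup X] [InnerProductSpace ℝ X] [CompleteSpace X] {i : V →L[ℝ] H}
    {D : V →L[ℝ] W} {e : V →L[ℝ] X} {ν : ℝ} {p : StrongDual ℝ V} {u : V} {σ : X} {f : H} :
    (∀ z, p z + ν * inner ℝ (D u) (D z) + inner ℝ σ (e z) = inner ℝ f (i z)) ↔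
      (InnerProductSpace.toDual ℝ V).symm p + ν • D.adjoint (D u) + e.adjoint σ
        = i.adjoint f := by
  rw [ext_iff_inner_right ℝ]
  simp only [inner_add_left, real_inner_smul_left, ContinuousLinearMap.adjoint_inner_left,
    InnerProductSpace.toDual_symm_apply]

end Riesz

theorem inner_sub_inner_le_iff {X : Type*} [NormedAddCommGroup X] [InnerProductSpace ℝ X]
    {w a b y : X} :
    inner ℝ w y - inner ℝ a y ≤ inner ℝ b y ↔ inner ℝ (w - a - b) y ≤ 0 := by
  rw [inner_sub_left, inner_sub_left, sub_nonpos]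

section Model

variable {Ω ΓD : Set E3}

theorem toVDual_eq (u : HVec Ω) : toVDual Ω ΓD u = innerSL ℝ ((toH Ω ΓD).adjoint u) := by
  ext z
  exact (ContinuousLinearMap.adjoint_inner_left (toH Ω ΓD) z u).symm

theorem isSolution_iff {T ν : ℝ} {f : ℝ → HVec Ω} {h σstar : ℝ → HSym Ω}
    {g : ℝ → (closure Ω →ᵇ ℝ)} {v₀ : VSp Ω ΓD} {σ₀ : HSym Ω} {v : ℝ → HVec Ω}
    {σ : ℝ → HSym Ω} :
    IsSolution Ω ΓD T ν f h σstar g v₀ σ₀ v σ ↔ ∃ u v' σ', IsCoupledSolution T ν (toH Ω ΓD)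
      (grad Ω ΓD) (strain Ω ΓD) (fun t => (toH Ω ΓD).adjoint (f t)) h (K Ω g σstar)
      (toH Ω ΓD v₀) σ₀ v σ u v' σ' := by
  simp only [IsSolution, gradForm, toVDual_eq, motion_iff, inner_sub_inner_le_iff]
  constructor
  · rintro ⟨u, v', σ', hv', hv, hu, hvu, hσ', hK, hmotion, hflow, hv₀, hσ₀⟩
    exact ⟨u, _, σ', hv'.of_innerSL, hv, hu, hvu, hσ', hK, hmotion, hflow, hv₀, hσ₀⟩
  · rintro ⟨u, v', σ', h⟩
    refine ⟨u, fun t => innerSL ℝ (v' t), σ', h.velocity_deriv.innerSL, h.velocity_bounded,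
      h.velocity_memLp, h.velocity_eq, h.stress_deriv, h.stress_mem, ?_, h.flow,
      h.velocity_zero, h.stress_zero⟩
    filter_upwards [h.motion] with t ht
    exact (congrArg (· + _ + _) ((InnerProductSpace.toDual ℝ _).symm_apply_apply (v' t))).trans ht

end Model

end

end ViscousPlasticity

theorem theorem2p3_general {Ω ΓD : Set ViscousPlasticity.E3} (hΩ : IsOpen Ω)
    (hΓ : ΓD ⊆ frontier Ω) {T : ℝ} (hT : 0 < T) {ν : ℝ} (hν : 0 < ν)
    {f : ℝ → ViscousPlasticity.HVec Ω} (hf : MemLp f 2 (ViscousPlasticity.timeMeasure T))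
    {h : ℝ → ViscousPlasticity.HSym Ω} (hh : MemLp h 2 (ViscousPlasticity.timeMeasure T))
    {σstar : ℝ → ViscousPlasticity.HSym Ω}
    (hσstar : ∃ σstar', ViscousPlasticity.HasH1Deriv T σstar σstar')
    {g : ℝ → (closure Ω →ᵇ ℝ)} (hg : ∃ g', ViscousPlasticity.HasH1Deriv T g g')
    {C : ℝ} (hC : 0 < C) (hgC : ∀ t ∈ Icc 0 T, ∀ x, C ≤ g t x)
    (v₀ : ViscousPlasticity.VSp Ω ΓD) {σ₀ : ViscousPlasticity.HSym Ω}
    (hσ₀ : σ₀ ∈ ViscousPlasticity.K Ω g σstar 0) :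
    (∃ v σ, ViscousPlasticity.IsSolution Ω ΓD T ν f h σstar g v₀ σ₀ v σ) ∧
    ∀ v₁ v₂ σ₁ σ₂, ViscousPlasticity.IsSolution Ω ΓD T ν f h σstar g v₀ σ₀ v₁ σ₁ →
      ViscousPlasticity.IsSolution Ω ΓD T ν f h σstar g v₀ σ₀ v₂ σ₂ →
      ∀ t ∈ Icc 0 T, v₁ t = v₂ t ∧ σ₁ t = σ₂ t := by
  obtain ⟨σstar', hσstar⟩ := hσstar
  obtain ⟨g', hg⟩ := hg
  have hi := ViscousPlasticity.injective_adjoint_toH hΩ hΓ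
  have hnorm := ViscousPlasticity.isGraphNorm_toH_grad (Ω := Ω) (ΓD := ΓD)
  have hF := (ViscousPlasticity.toH Ω ΓD).adjoint.comp_memLp' hf
  have hK : ViscousPlasticity.K Ω g σstar
      = fun t => {τ | τ + σstar t ∈ ViscousPlasticity.Ktilde Ω (g t + (0 : ℝ) • 1)} := by
    simp only [zero_smul, add_zero]
    rfl
  rw [hK] at hσ₀
  simp only [ViscousPlasticity.isSolution_iff, hK]
  constructor
  · exact ViscousPlasticity.exists_coupledSolution hT hν hnorm hi hF hh hσstar
      (ViscousPlasticity.isSweepingFamily_Ktilde hg hC hgC) v₀ hσ₀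
  · rintro v₁ v₂ σ₁ σ₂ ⟨u₁, v₁', σ₁', h₁⟩ ⟨u₂, v₂', σ₂', h₂⟩
    exact h₁.unique hT hν hnorm hi hF hh h₂

theorem theorem2p3
    (Ω ΓD ΓN : Set ViscousPlasticity.E3) (hΩ : ViscousPlasticity.IsSmoothDomain Ω)
    (hΓDm : MeasurableSet ΓD) (hΓNm : MeasurableSet ΓN)
    (hΓ : ΓD ∪ ΓN = frontier Ω) (hdisj : Disjoint ΓD ΓN)
    (hΓD : 0 < (μH[2] : Measure ViscousPlasticity.E3) ΓD)
    (hΓN : 0 < (μH[2] : Measure ViscousPlasticity.E3) ΓN)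
    (T : ℝ) (hT : 0 < T) (ν : ℝ) (hν : ν ∈ Ioc (0 : ℝ) 1)
    -- the force and the strain-rate datum
    (f : ℝ → ViscousPlasticity.HVec Ω) (hf : MemLp f 2 (ViscousPlasticity.timeMeasure T))
    (h : ℝ → ViscousPlasticity.HSym Ω) (hh : MemLp h 2 (ViscousPlasticity.timeMeasure T))
    -- the translation of the constraint set
    (σstar : ℝ → ViscousPlasticity.HSym Ω)
    (hσstar : ∃ σstar', ViscousPlasticity.HasH1Deriv T σstar σstar')
    -- the threshold function
    (g : ℝ → (closure Ω →ᵇ ℝ)) (hg : ∃ g', ViscousPlasticity.HasH1Deriv T g g')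
    (hgc : ContinuousOn (fun p : ℝ × closure Ω => g p.1 p.2) (Icc 0 T ×ˢ univ))
    (hgb : ∃ C₁ C₂ : ℝ, 0 < C₁ ∧ 0 < C₂ ∧ ∀ t ∈ Icc 0 T, ∀ x, C₁ ≤ g t x ∧ g t x ≤ C₂)
    -- the initial data
    (v₀ : ViscousPlasticity.VSp Ω ΓD) (σ₀ : ViscousPlasticity.HSym Ω)
    (hσ₀ : σ₀ ∈ ViscousPlasticity.K Ω g σstar 0 ∩ ViscousPlasticity.VSym Ω ΓD) :
    (∃ (v : ℝ → ViscousPlasticity.HVec Ω) (σ : ℝ → ViscousPlasticity.HSym Ω),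
      ViscousPlasticity.IsSolution Ω ΓD T ν f h σstar g v₀ σ₀ v σ) ∧
    (∀ (v₁ v₂ : ℝ → ViscousPlasticity.HVec Ω) (σ₁ σ₂ : ℝ → ViscousPlasticity.HSym Ω),
      ViscousPlasticity.IsSolution Ω ΓD T ν f h σstar g v₀ σ₀ v₁ σ₁ →
      ViscousPlasticity.IsSolution Ω ΓD T ν f h σstar g v₀ σ₀ v₂ σ₂ →
      ∀ t ∈ Icc 0 T, v₁ t = v₂ t ∧ σ₁ t = σ₂ t) := by
  obtain ⟨C₁, C₂, hC₁, -, hC⟩ := hgb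
  exact theorem2p3_general hΩ.isOpen (hΓ ▸ subset_union_left) hT hν.1 hf hh hσstar hg hC₁
    (fun t ht x => (hC t ht x).1) v₀ hσ₀.1
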